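/- **Setting.** Let $G,M,c>0$ and $r_g=GM/c^2$. Consider a rotating, non-extremal Kerr–Newman black hole (vanishing cosmological constant) of mass $M$ with dimensionless spin $a\neq0$ and charge $e$ (that is, spin $a\,r_g$ and charge $e\,r_g$ in units of length), $a^2+e^2<1$, and dimensionless horizon radii $r'_\pm=1\pm\sqrt{1-a^2-e^2}$. Consider a timelike polar geodesic ($L=0$) of a unit-mass particle with energy $E$, $E^2<1$, and dimensionless Carter constant $Q>a^2(1-E^2)$ (dimensional value $Q\,r_g^2$). In Boyer–Lindquist coordinates, with $\hat a=a r_g$, $\hat e=e r_g$, $\hat Q=Qr_g^2$, $\Delta=r^2+\hat a^2+\hat e^2-2r_gr$, $\rho^2=r^2+\hat a^2\cos^2\theta$, the parameter $\lambda$ being $c$ times proper time and $\theta$ being unrolled to a real variable, it satisfies $$\rho^4\Big(\frac{dr}{d\lambda}\Big)^2=(r^2+\hat a^2)^2E^2-\Delta\,(r^2+\hat Q+\hat a^2E^2),\qquad \rho^4\Big(\frac{d\theta}{d\lambda}\Big)^2=\hat Q-\hat a^2(1-E^2)\cos^2\theta,$$ $$c\rho^2\frac{dt}{d\lambda}=\frac{(r^2+\hat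 a^2)^2E}{\Delta}-\hat a^2E\sin^2\theta,\qquad \rho^2\frac{d\phi}{d\lambda}=-\hat aE+\frac{\hat a(r^2+\hat a^2)E}{\Delta}.$$ Assume that the dimensionless radial quartic $R(x)=(x^2+a^2)^2E^2-(x^2+a^2+e^2-2x)(x^2+Q+a^2E^2)$ has four real roots $\alpha>\beta>\gamma>\delta$ with $\beta>r'_+$, and that along the geodesic $r$ increases strictly from the periapsis $\beta r_g$ to the apoapsis $\alpha r_g$ and then decreases strictly back to $\beta r_g$, the initial periapsis passage taking place in the equatorial plane ($\cos\theta=0$). Let $P_{KN}$ be the coordinate time elapsed between these two successive periapsis passages. **Notation.** Put $$\omega=\frac{\alpha-\beta}{\alpha-\gamma},\quad \kappa^2=\omega\,\frac{\delta-\gamma}{\delta-\beta},\quad \kappa_\pm^2=\omega\,\frac{r'_\pm-\gamma}{r'_\pm-\beta},\quad \kappa'^2=\frac{a^2(1-E^2)}{Q},\quad H_\pm=\sqrt{1-E^2}\,(\beta-r'_\pm)\sqrt{\alpha-\beta}\sqrt{\beta-\delta},$$ $$A_+=-\frac{a^2+e^2-2r'_+}{r'_--r'_+},\qquad A_-=-\frac{-a^2-e^2+2r'_-}{r'_--r'_+}.$$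 $F(a_1,a_2,a_3,x)=\sum_n\frac{(a_1)_n(a_2)_n}{(a_3)_n\,n!}x^n$ is Gauss's hypergeometric function and $F_1(a_1,b,b',c_1,x,y)=\sum_{m,n\ge0}\frac{(a_1)_{m+n}(b)_m(b')_n}{(c_1)_{m+n}\,m!\,n!}x^my^n$ is Appell's first hypergeometric function. $\mathrm{am}(\cdot,k^2)$ is the Jacobi amplitude, the inverse function of $\Psi\mapsto\int_0^\Psi(1-k^2\sin^2\psi)^{-1/2}d\psi$, and $$\varphi=\mathrm{am}\Big(\sqrt Q\,\frac{4}{\sqrt{1-E^2}}\frac1{\sqrt{\alpha-\gamma}}\frac1{\sqrt{\beta-\delta}}\,\frac\pi2\,F(\tfrac12,\tfrac12,1,\kappa^2),\ \kappa'^2\Big).$$ For $b=\pm\frac12$, let $S_b$ be the real-analytic function on $\mathbb R$ with $S_b(\psi)=\sin\psi\;F_1(\tfrac12,\tfrac12,b,\tfrac32,\sin^2\psi,\kappa'^2\sin^2\psi)$ for $|\psi|<\pi/2$, i.e. the right-hand side continued analytically along the real axis. **Claim.** The functions $S_{\pm1/2}$ exist (they are unique), and $$\begin{aligned} cP_{KN}={}&\frac{2E\beta^2r_g}{\sqrt{1-E^2}\sqrt{\alpha-\gamma}\sqrt{\beta-\delta}}\Big[\pi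 F_1(\tfrac12,2,\tfrac12,1,\omega,\kappa^2)-\frac{2\omega\gamma}{\beta}\frac\pi2F_1(\tfrac32,2,\tfrac12,2,\omega,\kappa^2)+\frac{\gamma^2\omega^2}{\beta^2}\frac{3\pi}8F_1(\tfrac52,2,\tfrac12,3,\omega,\kappa^2)\Big]\\ &+2E(a^2-e^2)r_g\sqrt{\tfrac{\omega}{1-E^2}}\,\frac{\pi F(\frac12,\frac12,1,\kappa^2)}{\sqrt{(\alpha-\beta)(\beta-\delta)}}\\ &+4Er_g\sqrt{\tfrac{\omega}{1-E^2}}\,\frac{\beta}{\sqrt{(\alpha-\beta)(\beta-\delta)}}\Big[\pi F_1(\tfrac12,1,\tfrac12,1,\omega,\kappa^2)-\frac{\omega\gamma}{\beta}\frac\pi2F_1(\tfrac32,1,\tfrac12,2,\omega,\kappa^2)\Big]\\ &+8Er_g\sqrt{\tfrac{\omega}{1-E^2}}\,\frac{\pi F(\frac12,\frac12,1,\kappa^2)}{\sqrt{(\alpha-\beta)(\beta-\delta)}}\\ &-8Er_g\big[A_+X_++A_-X_-\big]\\ &+2Er_g\Big[\frac{4e^2r'_+-e^4}{-2\sqrt{1-a^2-e^2}}X_++\frac{e^4-4e^2r'_-}{-2\sqrt{1-a^2-e^2}}X_-\Big]\\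 &-\frac{a^2Er_g}{\sqrt Q}\Big[S_{1/2}(\varphi)+\frac{-S_{1/2}(\varphi)+S_{-1/2}(\varphi)}{\kappa'^2}\Big], \end{aligned}$$ where $$X_\pm=-\frac{\omega^{3/2}}{H_\pm}\frac\pi2F_1(\tfrac32,1,\tfrac12,2,\kappa_\pm^2,\kappa^2)+\frac{\omega^{1/2}}{H_\pm}\,\pi\,F_1(\tfrac12,1,\tfrac12,1,\kappa_\pm^2,\kappa^2).$$ -/

import Mathlib

open Real

noncomputable section

namespace KerrNewman

/-- The horizon function `Δ(r) = r² + a² + e² - 2 m r`. All arguments have the dimension of a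
length, `m` being the gravitational radius `G M / c²`; `m = 1` gives the dimensionless form. -/
def Delta (m a e r : ℝ) : ℝ := r ^ 2 + a ^ 2 + e ^ 2 - 2 * m * r

/-- The radial quartic `R(r)` of timelike geodesics with vanishing axial angular momentum
(particle of unit mass, vanishing cosmological constant). -/
def radialPoly (m a e E Q r : ℝ) : ℝ :=
  ((r ^ 2 + a ^ 2) * E) ^ 2 - Delta m a e r * (r ^ 2 + Q + a ^ 2 * E ^ 2)

/-- The polar potential `Θ(θ)` of timelike geodesics with vanishing axial angular momentum. -/
def polarPotential (a E Q θ : ℝ) : ℝ := Q - a ^ 2 * (1 - E ^ 2) * cos θ ^ 2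

/-- `ρ² = r² + a² cos² θ`. -/
def rhoSq (a r θ : ℝ) : ℝ := r ^ 2 + a ^ 2 * cos θ ^ 2

/-- The geodesic equations in Boyer-Lindquist coordinates `(t, r, θ, ϕ)`, on a set `I` of
parameters, of a unit mass particle in a polar (`L = 0`) timelike orbit with energy `E` and Carter
constant `Q`. The parameter is the proper time multiplied by `c`. The angle `θ` is
unrolled: it runs through `ℝ`, and crossing the symmetry axis means crossing a multiple of `π`. -/
structure IsPolarGeodesicOn (c m a e E Q : ℝ) (I : Set ℝ) (t r θ ϕ : ℝ → ℝ) : Prop where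
  differentiableAt_t : ∀ s ∈ I, DifferentiableAt ℝ t s
  differentiableAt_r : ∀ s ∈ I, DifferentiableAt ℝ r s
  differentiableAt_θ : ∀ s ∈ I, DifferentiableAt ℝ θ s
  differentiableAt_ϕ : ∀ s ∈ I, DifferentiableAt ℝ ϕ s
  radial_eq : ∀ s ∈ I, (rhoSq a (r s) (θ s) * deriv r s) ^ 2 = radialPoly m a e E Q (r s)
  polar_eq : ∀ s ∈ I, (rhoSq a (r s) (θ s) * deriv θ s) ^ 2 = polarPotential a E Q (θ s)
  time_eq : ∀ s ∈ I, c * rhoSq a (r s) (θ s) * deriv t s =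
    (r s ^ 2 + a ^ 2) * ((r s ^ 2 + a ^ 2) * E) / Delta m a e (r s) - a ^ 2 * E * sin (θ s) ^ 2
  azimuth_eq : ∀ s ∈ I, rhoSq a (r s) (θ s) * deriv ϕ s =
    -(a * E) + a / Delta m a e (r s) * ((r s ^ 2 + a ^ 2) * E)

/-- One radial revolution: the radius increases strictly from the periapsis `rP` at `s₀` to the
apoapsis `rA` at `s₁`, and decreases strictly back to the periapsis at `s₂`. -/
structure IsRadialRevolution (r : ℝ → ℝ) (rP rA s₀ s₁ s₂ : ℝ) : Prop where
  lt₀₁ : s₀ < s₁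
  lt₁₂ : s₁ < s₂
  eq₀ : r s₀ = rP
  eq₁ : r s₁ = rA
  eq₂ : r s₂ = rP
  increasing : StrictMonoOn r (Set.Icc s₀ s₁)
  decreasing : StrictAntiOn r (Set.Icc s₁ s₂)

/-- The Pochhammer symbol `(x)ₙ = x (x + 1) ⋯ (x + n - 1)`. -/
def poch (x : ℝ) (n : ℕ) : ℝ := (ascPochhammer ℝ n).eval x

/-- Appell's first hypergeometric function `F₁(α, β, β', γ, x, y)`, as the sum of its double
series (absolutely convergent for `|x|, |y| < 1`). -/
def appellF1 (α β β' γ x y : ℝ) : ℝ :=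
  ∑' p : ℕ × ℕ, poch α (p.1 + p.2) * poch β p.1 * poch β' p.2 /
    (poch γ (p.1 + p.2) * p.1.factorial * p.2.factorial) * x ^ p.1 * y ^ p.2

/-- `S` is the real-analytic continuation to the whole real line of the function
`φ ↦ sin φ · F₁(1/2, 1/2, b, 3/2, sin² φ, k2 sin² φ)`, given by its series for `|φ| < π / 2`.
By the identity theorem there is at most one such `S`. -/
def IsAppellContinuation (b k2 : ℝ) (S : ℝ → ℝ) : Prop :=
  AnalyticOnNhd ℝ S Set.univ ∧ ∀ φ ∈ Set.Ioo (-(π / 2)) (π / 2),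
    S φ = sin φ * appellF1 (1 / 2) (1 / 2) b (3 / 2) (sin φ ^ 2) (k2 * sin φ ^ 2)

/-- The Jacobi amplitude `am(u, k2)`, `0 ≤ k2 < 1`: the inverse of the incomplete elliptic integral
of the first kind, which is a bijection of the real line. -/
def jacobiAm (u k2 : ℝ) : ℝ :=
  Function.invFun (fun Ψ : ℝ => ∫ ψ in (0 : ℝ)..Ψ, 1 / √(1 - k2 * sin ψ ^ 2)) u

end KerrNewman

end

noncomputable section

namespace KerrNewman

/-! In the Mino parameter, whose differential is dλ/ρ², the radial and polar motions decouple, and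
the rate of t is a function of r minus a multiple of sin²θ. The elapsed time is therefore a complete
radial integral over one revolution, minus an incomplete polar integral up to the angle reached when
r is back at periapsis; `exists_time_of_revolution` carries this out.

Radial part: the Möbius substitution `uniformRadius` in sin²ψ turns dr/√R into a constant times
dψ/√(1 - κ² sin²ψ), and one revolution amounts to ψ running over [0, π] (`hasDerivAt_uniformAngle`,
`sub_eq_integral_of_revolution`). Partial fractions reduce (r² + a²)²/Δ to r², r, 1 and 1/(r - r'±).
Each of these gives complete integrals of Appell type, whose arguments lie in (0, 1) because both
horizons lie below the root γ (`lt_of_Delta_eq_zero`).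

Polar part: Θ is positive, so θ is monotone, and its displacement Ψ from the equator is the Jacobi
amplitude of √Q times the Mino time of the revolution (`exists_polar_angle`, `jacobiAm_integral`).
What is left is an integral of cos²Ψ, a combination of the incomplete elliptic integrals of the
first and second kinds; these are the continuations S₁/₂ and S₋₁/₂
(`isAppellContinuation_integral`).

All the F₁ series come from one termwise integration of a product of two binomial series,
`hasSum_integral_mul_binomials`. -/

/-! ### Binomial series and integral representations of F₁. -/

theorem hasSum_binomial (b : ℝ) {u : ℝ} (hu : |u| < 1) :
    HasSum (fun n : ℕ => poch b n / n.factorial * u ^ n) ((1 - u) ^ (-b)) := by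
  have h := (Real.one_add_rpow_hasFPowerSeriesOnBall_zero (a := -b)).hasSum
    (y := -u) (by simpa [Metric.mem_eball, edist_dist] using hu)
  -- The binomial series is ₂F₁(b, c; c) for any c that is not a nonpositive integer; the Pochhammer
  -- symbols of the choice c = 1 cancel below.
  rw [binomialSeries_eq_ordinaryHypergeometricSeries (b := (1 : ℝ))
    (by intro k; have : (0 : ℝ) ≤ k := k.cast_nonneg; linarith)] at h
  convert! h using 1
  · ext n
    have h1 : (ascPochhammer ℝ n).eval 1 ≠ 0 := by
      rw [ascPochhammer_eval_one]; exact_mod_cast n.factorial_ne_zero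
    simp [-FormalMultilinearSeries.apply_eq_prod_smul_coeff,
      FormalMultilinearSeries.compContinuousLinearMap,
      ordinaryHypergeometricSeries_apply_eq, poch]
    field_simp
    simp
  · simp [sub_eq_add_neg]

/-- Dominated convergence, with the absolutely convergent product of the binomial series at X and Y
as majorant. Keeping X, Y apart from x, y allows |x| = 1 as long as x·u stays away from modulus 1 on
the interval, as the incomplete integrals require. -/
theorem hasSum_integral_mul_binomials {b b' x y X Y p q : ℝ} {w u : ℝ → ℝ} (hw : Continuous w)
    (hu : Continuous u) (hX : |X| < 1) (hY : |Y| < 1)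
    (hbx : ∀ t ∈ Set.uIcc p q, |x * u t| ≤ |X|) (hby : ∀ t ∈ Set.uIcc p q, |y * u t| ≤ |Y|) :
    HasSum (fun n : ℕ × ℕ => poch b n.1 / n.1.factorial * (poch b' n.2 / n.2.factorial) *
      (x ^ n.1 * y ^ n.2) * ∫ t in p..q, w t * u t ^ (n.1 + n.2))
      (∫ t in p..q, w t * ((1 - x * u t) ^ (-b) * (1 - y * u t) ^ (-b'))) := by
  have hsum : ∀ (b : ℝ) {v : ℝ}, |v| < 1 →
      Summable fun n : ℕ => |poch b n / n.factorial * v ^ n| :=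
    fun b v hv => (hasSum_binomial b hv).summable.abs
  have hS : Summable fun n : ℕ × ℕ => |poch b n.1 / n.1.factorial * X ^ n.1| *
      |poch b' n.2 / n.2.factorial * Y ^ n.2| :=
    (hsum b hX).mul_of_nonneg (hsum b' hY) (fun _ => abs_nonneg _) (fun _ => abs_nonneg _)
  have e : ∀ (n : ℕ × ℕ) (t : ℝ), poch b n.1 / n.1.factorial * (poch b' n.2 / n.2.factorial) *
      (x ^ n.1 * y ^ n.2) * (w t * u t ^ (n.1 + n.2)) =
      w t * ((poch b n.1 / n.1.factorial * (x * u t) ^ n.1) *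
        (poch b' n.2 / n.2.factorial * (y * u t) ^ n.2)) := fun n t => by
    rw [mul_pow, mul_pow, pow_add]; ring
  have key := intervalIntegral.hasSum_integral_of_dominated_convergence
    (μ := MeasureTheory.volume) (a := p) (b := q)
    (F := fun (n : ℕ × ℕ) t => poch b n.1 / n.1.factorial * (poch b' n.2 / n.2.factorial) *
      (x ^ n.1 * y ^ n.2) * (w t * u t ^ (n.1 + n.2)))
    (f := fun t => w t * ((1 - x * u t) ^ (-b) * (1 - y * u t) ^ (-b')))
    (fun n t => |w t| * (|poch b n.1 / n.1.factorial * X ^ n.1| *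
      |poch b' n.2 / n.2.factorial * Y ^ n.2|)) ?_ ?_ ?_ ?_ ?_
  · simpa only [intervalIntegral.integral_const_mul] using key
  · intro n
    exact (by fun_prop : Continuous _).aestronglyMeasurable
  · intro n
    refine .of_forall fun t ht => ?_
    have ht' := Set.uIoc_subset_uIcc ht
    have h1 := pow_le_pow_left₀ (abs_nonneg _) (hbx t ht') n.1
    have h2 := pow_le_pow_left₀ (abs_nonneg _) (hby t ht') n.2
    rw [e]
    simp only [Real.norm_eq_abs, abs_mul _ _, abs_pow] at h1 h2 ⊢
    gcongr
  · exact .of_forall fun t _ => hS.mul_left _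
  · simp only [tsum_mul_left]
    exact (by fun_prop : Continuous _).intervalIntegrable _ _
  · refine .of_forall fun t ht => ?_
    have ht' := Set.uIoc_subset_uIcc ht
    have h1 := (hbx t ht').trans_lt hX
    have h2 := (hby t ht').trans_lt hY
    have hprod : Summable fun n : ℕ × ℕ => (poch b n.1 / n.1.factorial * (x * u t) ^ n.1) *
        (poch b' n.2 / n.2.factorial * (y * u t) ^ n.2) :=
      summable_mul_of_summable_norm (f := fun n : ℕ => poch b n / n.factorial * (x * u t) ^ n)
        (g := fun n : ℕ => poch b' n / n.factorial * (y * u t) ^ n) (hsum b h1) (hsum b' h2)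
    have hmul := HasSum.mul_left (w t) (HasSum.mul (hasSum_binomial b h1)
      (hasSum_binomial b' h2) hprod)
    simpa only [e] using hmul

/-- Wallis' product, read as a Pochhammer ratio: this is where the parameters p + 1/2 and p + 1 of
the complete F₁ come from. -/
theorem integral_sin_pow_even_eq_poch (p N : ℕ) :
    ∫ t in (0 : ℝ)..π, sin t ^ (2 * (p + N)) =
      (∫ t in (0 : ℝ)..π, sin t ^ (2 * p)) * (poch (p + 1 / 2) N / poch (p + 1) N) := by
  have h : ∀ N, poch ((p : ℝ) + 1) N ≠ 0 := fun N => (ascPochhammer_pos N _ (by positivity)).ne'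
  induction N with
  | zero => simp [poch]
  | succ N ih =>
    have h1 := h N
    rw [integral_sin_pow_even] at ih ⊢
    rw [← add_assoc, Finset.prod_range_succ, ← mul_assoc, ih]
    simp only [poch] at h1 ⊢
    rw [ascPochhammer_succ_eval, ascPochhammer_succ_eval]
    have h2 : (p : ℝ) + 1 + N ≠ 0 := by positivity
    have h3 : 2 * ((p : ℝ) + N) + 2 ≠ 0 := by positivity
    push_cast
    field_simp
    ring

/-- The Euler integral of Appell's `F₁` in its trigonometric form. -/
theorem integral_sin_pow_mul_eq_appellF1 (p : ℕ) {b b' x y : ℝ} (hx : |x| < 1) (hy : |y| < 1) :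
    ∫ t in (0 : ℝ)..π, sin t ^ (2 * p) *
        ((1 - x * sin t ^ 2) ^ (-b) * (1 - y * sin t ^ 2) ^ (-b')) =
      (∫ t in (0 : ℝ)..π, sin t ^ (2 * p)) * appellF1 (p + 1 / 2) b b' (p + 1) x y := by
  have hle : ∀ z t : ℝ, |z * sin t ^ 2| ≤ |z| := fun z t => by
    rw [abs_mul, abs_of_nonneg (sq_nonneg (sin t))]
    exact mul_le_of_le_one_right (abs_nonneg _) (sin_sq_le_one t)
  have h := hasSum_integral_mul_binomials (b := b) (b' := b') (x := x) (y := y) (p := 0) (q := π)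
    (w := fun t => sin t ^ (2 * p)) (u := fun t => sin t ^ 2) (by fun_prop) (by fun_prop) hx hy
    (fun t _ => hle x t) (fun t _ => hle y t)
  rw [← h.tsum_eq, appellF1, ← tsum_mul_left]
  refine tsum_congr fun n => ?_
  have e : ∀ t : ℝ, sin t ^ (2 * p) * (sin t ^ 2) ^ (n.1 + n.2) =
      sin t ^ (2 * (p + (n.1 + n.2))) := fun t => by ring
  simp only [e, integral_sin_pow_even_eq_poch]
  have h1 : poch ((p : ℝ) + 1) (n.1 + n.2) ≠ 0 := (ascPochhammer_pos _ _ (by positivity)).ne'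
  have h2 : (n.1.factorial : ℝ) ≠ 0 := by positivity
  have h3 : (n.2.factorial : ℝ) ≠ 0 := by positivity
  field_simp

theorem poch_half_div (N : ℕ) : poch (1 / 2) N / poch (3 / 2) N = 1 / (2 * N + 1) := by
  have h : poch (3 / 2) N ≠ 0 := (ascPochhammer_pos N _ (by norm_num)).ne'
  induction N with
  | zero => simp [poch]
  | succ N ih =>
    have h1 : poch (3 / 2) N ≠ 0 := (ascPochhammer_pos N _ (by norm_num)).ne'
    simp only [poch] at *
    rw [ascPochhammer_succ_eval, ascPochhammer_succ_eval, mul_div_mul_comm, ih h1]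
    push_cast
    field_simp
    ring

/-- The incomplete elliptic integrals as values of Appell's `F₁`. -/
theorem integral_eq_sin_mul_appellF1 (b : ℝ) {k φ : ℝ} (hk : 0 ≤ k) (hk1 : k < 1)
    (hφ : φ ∈ Set.Ioo (-(π / 2)) (π / 2)) :
    ∫ t in (0 : ℝ)..φ, (1 - k * sin t ^ 2) ^ (-b) =
      sin φ * appellF1 (1 / 2) (1 / 2) b (3 / 2) (sin φ ^ 2) (k * sin φ ^ 2) := by
  have hc : 0 < cos φ := cos_pos_of_mem_Ioo hφ
  have hs1 : sin φ ^ 2 < 1 := by nlinarith [sin_sq_add_cos_sq φ]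
  have hsub : ∀ t ∈ Set.uIcc 0 φ, t ∈ Set.Ioo (-(π / 2)) (π / 2) ∧ sin t ^ 2 ≤ sin φ ^ 2 := by
    intro t ht
    have hφ' := hφ
    obtain ⟨h1, h2⟩ := hφ
    rcases Set.mem_uIcc.1 ht with ⟨h3, h4⟩ | ⟨h3, h4⟩
    · refine ⟨⟨by linarith, by linarith⟩, pow_le_pow_left₀ (sin_nonneg_of_nonneg_of_le_pi h3
        (by linarith [pi_pos])) (sin_le_sin_of_le_of_le_pi_div_two (by linarith) h2.le h4) 2⟩
    · refine ⟨⟨by linarith, by linarith⟩, ?_⟩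
      have := pow_le_pow_left₀ (sin_nonneg_of_nonneg_of_le_pi (neg_nonneg.2 h4)
        (by linarith [pi_pos])) (sin_le_sin_of_le_of_le_pi_div_two (x := -t) (y := -φ)
          (by linarith) (by linarith) (by linarith)) 2
      simpa using this
  -- Here x = 1 is on the boundary of convergence; the majorant is taken at sin²φ, which is below 1
  -- because |φ| < π/2.
  have h := hasSum_integral_mul_binomials (b := 1 / 2) (b' := b) (x := 1) (y := k) (p := 0)
    (q := φ) (w := cos) (u := fun t => sin t ^ 2) (X := sin φ ^ 2) (Y := k * sin φ ^ 2)
    (by fun_prop) (by fun_prop)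
    (by rwa [abs_of_nonneg (sq_nonneg _)])
    (by rw [abs_of_nonneg (by positivity)]; nlinarith [sq_nonneg (sin φ)])
    (fun t ht => by
      rw [one_mul, abs_of_nonneg (sq_nonneg _), abs_of_nonneg (sq_nonneg _)]; exact (hsub t ht).2)
    (fun t ht => by
      rw [abs_of_nonneg (by positivity), abs_of_nonneg (by positivity)]
      exact mul_le_mul_of_nonneg_left (hsub t ht).2 hk)
  -- Writing 1 = cos t · (1 - sin²t)^(-1/2), valid where cos t > 0, produces the weight d(sin t) and
  -- the parameter 1/2 of the first variable.
  have e : ∫ t in (0 : ℝ)..φ, (1 - k * sin t ^ 2) ^ (-b) =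
      ∫ t in (0 : ℝ)..φ, cos t * ((1 - 1 * sin t ^ 2) ^ (-(1 / 2 : ℝ)) *
        (1 - k * sin t ^ 2) ^ (-b)) := by
    refine intervalIntegral.integral_congr fun t ht => ?_
    have hct : 0 < cos t := cos_pos_of_mem_Ioo (hsub t ht).1
    have : (1 - 1 * sin t ^ 2) = cos t ^ 2 := by linarith [sin_sq_add_cos_sq t]
    simp only [this]
    rw [rpow_neg (sq_nonneg _), ← sqrt_eq_rpow, sqrt_sq hct.le, ← mul_assoc,
      mul_inv_cancel₀ hct.ne', one_mul]
  rw [e, ← h.tsum_eq, appellF1, ← tsum_mul_left]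
  refine tsum_congr fun n => ?_
  have hint : ∀ N : ℕ, ∫ t in (0 : ℝ)..φ, cos t * (sin t ^ 2) ^ N =
      sin φ ^ (2 * N + 1) * (poch (1 / 2) N / poch (3 / 2) N) := by
    intro N
    rw [poch_half_div]
    have : ∀ t ∈ Set.uIcc 0 φ, HasDerivAt (fun t => sin t ^ (2 * N + 1) * (1 / (2 * N + 1)))
        (cos t * (sin t ^ 2) ^ N) t := by
      intro t _
      convert! (((hasDerivAt_sin t).pow (2 * N + 1)).mul_const (1 / (2 * (N : ℝ) + 1))) using 1
      push_cast
      field_simp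
      ring
    rw [intervalIntegral.integral_eq_sub_of_hasDerivAt this
      ((by fun_prop : Continuous _).intervalIntegrable _ _)]
    simp
  rw [hint]
  have h1 : poch (3 / 2) (n.1 + n.2) ≠ 0 := (ascPochhammer_pos _ _ (by norm_num)).ne'
  have h2 : (n.1.factorial : ℝ) ≠ 0 := by positivity
  have h3 : (n.2.factorial : ℝ) ≠ 0 := by positivity
  field_simp
  ring

/-- Since 1 - k sin² is positive on the real line, near each real point the integrand extends
holomorphically to a complex disc and has a primitive there. On the real axis the real part of that
primitive differs from the integral by a constant. -/
theorem analyticOnNhd_integral_rpow (b : ℝ) {k : ℝ} (hk : 0 ≤ k) (hk1 : k < 1) :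
    AnalyticOnNhd ℝ (fun φ => ∫ t in (0 : ℝ)..φ, (1 - k * sin t ^ 2) ^ (-b)) Set.univ := by
  intro x _
  have hpos : ∀ t : ℝ, 0 < 1 - k * sin t ^ 2 := fun t => by
    nlinarith [sin_sq_le_one t, sq_nonneg (sin t)]
  have hcont : Continuous fun t : ℝ => (1 - k * sin t ^ 2) ^ (-b) :=
    (by fun_prop : Continuous fun t : ℝ => 1 - k * sin t ^ 2).rpow_const
      fun t => Or.inl (hpos t).ne'
  have hslit : {z : ℂ | 1 - (k : ℂ) * Complex.sin z ^ 2 ∈ Complex.slitPlane} ∈ nhds (x : ℂ) := by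
    refine (by fun_prop : Continuous fun z : ℂ => 1 - (k : ℂ) * Complex.sin z ^ 2).continuousAt
      (Complex.isOpen_slitPlane.mem_nhds ?_)
    rw [← Complex.ofReal_sin]
    exact_mod_cast Complex.ofReal_mem_slitPlane.2 (hpos x)
  obtain ⟨ε, hε, hball⟩ := Metric.mem_nhds_iff.1 hslit
  have hdiff : DifferentiableOn ℂ (fun z : ℂ => (1 - (k : ℂ) * Complex.sin z ^ 2) ^ (-b : ℂ))
      (Metric.ball (x : ℂ) ε) := fun z hz =>
    (DifferentiableAt.cpow_const (f := fun z : ℂ => 1 - (k : ℂ) * Complex.sin z ^ 2)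
      (by fun_prop) (hball hz)).differentiableWithinAt
  obtain ⟨g, hg⟩ := hdiff.isExactOn_ball
  have hga : AnalyticAt ℂ g x :=
    (DifferentiableOn.analyticOnNhd (fun z hz => (hg z hz).differentiableAt.differentiableWithinAt)
      Metric.isOpen_ball) x (Metric.mem_ball_self hε)
  refine (hga.re_ofReal.add (analyticAt_const
    (v := (∫ t in (0 : ℝ)..x, (1 - k * sin t ^ 2) ^ (-b)) - (g x).re))).congr ?_
  filter_upwards [Metric.ball_mem_nhds x hε] with y hy
  have hsub : ∀ t ∈ Set.uIcc x y, (t : ℂ) ∈ Metric.ball (x : ℂ) ε := by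
    intro t ht
    rw [Metric.mem_ball, Complex.dist_of_im_eq (by simp)]
    exact Metric.mem_ball.1
      ((convex_ball x ε).ordConnected.uIcc_subset (Metric.mem_ball_self hε) hy ht)
  have hint : ∫ t in x..y, (1 - k * sin t ^ 2) ^ (-b) = (g y).re - (g x).re := by
    refine intervalIntegral.integral_eq_sub_of_hasDerivAt (f := fun t : ℝ => (g t).re)
      (fun t ht => ?_) (hcont.intervalIntegrable _ _)
    have h1 := (hg t (hsub t ht)).real_of_complex
    convert! h1 using 1
    have : (1 - (k : ℂ) * Complex.sin t ^ 2) = ((1 - k * sin t ^ 2 : ℝ) : ℂ) := by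
      push_cast; rfl
    simp only [this]
    rw [← Complex.ofReal_neg, ← Complex.ofReal_cpow (hpos t).le, Complex.ofReal_re]
  have := intervalIntegral.integral_add_adjacent_intervals
    (hcont.intervalIntegrable (μ := MeasureTheory.volume) 0 x) (hcont.intervalIntegrable x y)
  simp only [← this, hint, Pi.add_apply]
  ring

theorem isAppellContinuation_integral (b : ℝ) {k : ℝ} (hk : 0 ≤ k) (hk1 : k < 1) :
    IsAppellContinuation b k (fun φ => ∫ t in (0 : ℝ)..φ, (1 - k * sin t ^ 2) ^ (-b)) :=
  ⟨analyticOnNhd_integral_rpow b hk hk1, fun _ hφ => integral_eq_sin_mul_appellF1 b hk hk1 hφ⟩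

/-- The complete elliptic integral of the first kind. -/
theorem integral_eq_ordinaryHypergeometric {y : ℝ} (hy : |y| < 1) :
    ∫ t in (0 : ℝ)..π, (1 - y * sin t ^ 2) ^ (-(1 / 2) : ℝ) =
      π * ordinaryHypergeometric (1 / 2 : ℝ) (1 / 2 : ℝ) (1 : ℝ) y := by
  have h := integral_sin_pow_mul_eq_appellF1 0 (b := 0) (b' := 1 / 2) (x := 0) (y := y) (by simp) hy
  simp only [mul_zero, pow_zero, one_mul, zero_mul, sub_zero, neg_zero, rpow_zero,
    intervalIntegral.integral_const, smul_eq_mul, mul_one, Nat.cast_zero, zero_add] at h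
  rw [h, ordinaryHypergeometric_eq_tsum, appellF1]
  congr 1
  -- At x = 0 only the terms with first index 0 survive, so the double sum collapses along n ↦ (0,
  -- n).
  have hinj : Function.Injective fun n : ℕ => (0, n) := fun _ _ h => (Prod.ext_iff.1 h).2
  rw [← hinj.tsum_eq]
  · refine tsum_congr fun n => ?_
    simp [poch]
    field_simp
    simp
  · rintro ⟨m, n⟩ hmn
    rcases m with _ | m
    · exact ⟨n, rfl⟩
    · simp at hmn

/-! ### Uniformisation of the radial motion. -/

/-- The radius as a function of the angle that uniformises the radial motion. -/
def uniformRadius (α β γ ψ : ℝ) : ℝ :=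
  (β - γ * ((α - β) / (α - γ)) * sin ψ ^ 2) / (1 - (α - β) / (α - γ) * sin ψ ^ 2)

/-- The uniformising angle in `[0, π / 2]` of a radius between `β` and `α`. -/
def uniformAngle (α β γ x : ℝ) : ℝ :=
  arccos (1 - 2 * ((x - β) * (α - γ) / ((α - β) * (x - γ)))) / 2

section

variable {α β γ δ : ℝ}

theorem one_sub_mul_sin_sq_pos {ω : ℝ} (h0 : 0 ≤ ω) (h : ω < 1) (ψ : ℝ) :
    0 < 1 - ω * sin ψ ^ 2 := by
  nlinarith [sin_sq_le_one ψ, sq_nonneg (sin ψ)]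

theorem ratio_mem_Ioo (hαβ : β < α) (hβγ : γ < β) :
    (α - β) / (α - γ) ∈ Set.Ioo (0 : ℝ) 1 :=
  ⟨div_pos (by linarith) (by linarith), (div_lt_one (by linarith)).2 (by linarith)⟩

theorem uniformRadius_mem_Icc (hαβ : β < α) (hβγ : γ < β) (ψ : ℝ) :
    uniformRadius α β γ ψ ∈ Set.Icc β α := by
  obtain ⟨h0, h1⟩ := ratio_mem_Ioo hαβ hβγ
  have hpos := one_sub_mul_sin_sq_pos h0.le h1 ψ
  have e : (α - β) / (α - γ) * (α - γ) = α - β := div_mul_cancel₀ _ (by linarith)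
  have hs := sq_nonneg (sin ψ)
  have hs' := sin_sq_le_one ψ
  refine ⟨(le_div_iff₀ hpos).2 ?_, (div_le_iff₀ hpos).2 ?_⟩
  · nlinarith [mul_nonneg (mul_nonneg h0.le hs) (sub_nonneg.2 hβγ.le)]
  · have : (α - β) / (α - γ) * (α - γ) * sin ψ ^ 2 ≤ α - β := by
      rw [e]; nlinarith
    nlinarith

theorem continuous_uniformRadius (hαβ : β < α) (hβγ : γ < β) :
    Continuous (uniformRadius α β γ) := by
  obtain ⟨h0, h1⟩ := ratio_mem_Ioo hαβ hβγ
  exact Continuous.div (by fun_prop) (by fun_prop)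
    fun ψ => (one_sub_mul_sin_sq_pos h0.le h1 ψ).ne'

theorem uniformAngle_left : uniformAngle α β γ β = 0 := by
  simp [uniformAngle]

theorem uniformAngle_right (hαβ : β < α) (hβγ : γ < β) : uniformAngle α β γ α = π / 2 := by
  have h1 : α - β ≠ 0 := by linarith
  have h2 : α - γ ≠ 0 := by linarith
  rw [uniformAngle, div_self (mul_ne_zero h1 h2)]
  norm_num

theorem continuousOn_uniformAngle (hαβ : β < α) (hβγ : γ < β) :
    ContinuousOn (uniformAngle α β γ) (Set.Icc β α) := by
  have : ContinuousOn (fun x : ℝ => 1 - 2 * ((x - β) * (α - γ) / ((α - β) * (x - γ))))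
      (Set.Icc β α) := by
    refine ContinuousOn.sub continuousOn_const (ContinuousOn.mul continuousOn_const
      (ContinuousOn.div (by fun_prop) (by fun_prop) fun x hx => ?_))
    exact mul_ne_zero (by linarith) (by linarith [hx.1])
  exact (continuous_arccos.comp_continuousOn this).div_const 2

/-- The half-angle formula: half of arccos(1 - 2w) has squared sine w, with no square root of w
needed in the definition. -/
theorem sin_uniformAngle_sq (hβγ : γ < β) {x : ℝ} (hx : x ∈ Set.Ioo β α) :
    sin (uniformAngle α β γ x) ^ 2 = (x - β) * (α - γ) / ((α - β) * (x - γ)) ∧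
      0 < (x - β) * (α - γ) / ((α - β) * (x - γ)) ∧
      (x - β) * (α - γ) / ((α - β) * (x - γ)) < 1 := by
  obtain ⟨h1, h2⟩ := hx
  have hd : 0 < (α - β) * (x - γ) := mul_pos (by linarith) (by linarith)
  have hw : 0 < (x - β) * (α - γ) / ((α - β) * (x - γ)) :=
    div_pos (mul_pos (by linarith) (by linarith)) hd
  have hw1 : (x - β) * (α - γ) / ((α - β) * (x - γ)) < 1 := by
    rw [div_lt_one hd]; nlinarith
  refine ⟨?_, hw, hw1⟩
  rw [sin_sq_eq_half_sub, uniformAngle, mul_div_cancel₀ _ two_ne_zero,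
    cos_arccos (by linarith) (by linarith)]
  ring

theorem uniformRadius_uniformAngle (hαβ : β < α) (hβγ : γ < β) {x : ℝ}
    (hx : x ∈ Set.Ioo β α) : uniformRadius α β γ (uniformAngle α β γ x) = x := by
  rw [uniformRadius, (sin_uniformAngle_sq hβγ hx).1]
  have h1 : α - β ≠ 0 := by linarith
  have h2 : α - γ ≠ 0 := by linarith
  have h3 : x - γ ≠ 0 := by linarith [hx.1]
  have h4 : β - γ ≠ 0 := by linarith
  have e : 1 - (α - β) / (α - γ) * ((x - β) * (α - γ) / ((α - β) * (x - γ))) =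
      (β - γ) / (x - γ) := by
    field_simp; ring
  rw [e]
  field_simp
  ring

/-- The elliptic modulus of the radial motion. -/
def radialModulus (α β γ δ : ℝ) : ℝ := (α - β) / (α - γ) * ((δ - γ) / (δ - β))

/-- Serves both for κ², with r' = δ, and for κ±², with r' a horizon radius. -/
theorem mul_ratio_mem_Ioo {ω γ' r' β' : ℝ} (hω : ω ∈ Set.Ioo (0 : ℝ) 1) (h1 : r' < γ')
    (h2 : γ' < β') : ω * ((r' - γ') / (r' - β')) ∈ Set.Ioo (0 : ℝ) 1 := by
  have h : 0 < (r' - γ') / (r' - β') := div_pos_of_neg_of_neg (by linarith) (by linarith)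
  have h' : (r' - γ') / (r' - β') < 1 := (div_lt_one_of_neg (by linarith)).2 (by linarith)
  exact ⟨mul_pos hω.1 h, mul_lt_one_of_nonneg_of_lt_one_left hω.1.le hω.2 h'.le⟩

theorem radialModulus_mem_Ioo (hαβ : β < α) (hβγ : γ < β) (hγδ : δ < γ) :
    radialModulus α β γ δ ∈ Set.Ioo (0 : ℝ) 1 :=
  mul_ratio_mem_Ioo (ratio_mem_Ioo hαβ hβγ) hγδ hβγ

/-- The differential identity dx/√R = const · dψ/√(1 - κ² sin²ψ), which explains the choice of
substitution and of modulus. -/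
theorem hasDerivAt_uniformAngle (hαβ : β < α) (hβγ : γ < β) (hγδ : δ < γ) {l : ℝ} (hl : 0 < l)
    {x : ℝ} (hx : x ∈ Set.Ioo β α) :
    HasDerivAt (uniformAngle α β γ) (√l * √(α - γ) * √(β - δ) / 2 *
      √(1 - radialModulus α β γ δ * sin (uniformAngle α β γ x) ^ 2) /
        √(l * ((α - x) * (x - β) * (x - γ) * (x - δ)))) x := by
  obtain ⟨hs, hw, hw1⟩ := sin_uniformAngle_sq hβγ hx
  obtain ⟨hx1, hx2⟩ := hx
  have h1 : 0 < α - β := by linarith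
  have h2 : 0 < α - γ := by linarith
  have h3 : 0 < x - γ := by linarith
  have h4 : 0 < β - γ := by linarith
  have h5 : 0 < β - δ := by linarith
  have h6 : 0 < x - δ := by linarith
  have h7 : 0 < x - β := by linarith
  have h8 : 0 < α - x := by linarith
  have hR : 0 < l * ((α - x) * (x - β) * (x - γ) * (x - δ)) := by positivity
  rw [hs]
  have hz : HasDerivAt (fun x : ℝ => (x - β) * (α - γ) / ((α - β) * (x - γ)))
      ((β - γ) * (α - γ) / ((α - β) * (x - γ) ^ 2)) x := by
    convert! (((hasDerivAt_id x).sub_const β).mul_const (α - γ)).div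
      (((hasDerivAt_id x).sub_const γ).const_mul (α - β)) (by positivity) using 1
    simp only [id]
    field_simp
    ring
  set w := (x - β) * (α - γ) / ((α - β) * (x - γ)) with hwdef
  have hD := ((hasDerivAt_arccos (x := 1 - 2 * w) (by linarith) (by linarith)).comp x
    ((hz.const_mul 2).const_sub 1)).div_const 2
  convert! hD using 1
  have hzz : 0 < 1 - (1 - 2 * w) ^ 2 := by nlinarith
  -- Both sides are nonnegative, so squares may be compared; these are rational in x.
  have key : √l * √(α - γ) * √(β - δ) / 2 * √(1 - radialModulus α β γ δ * w) *
      √(1 - (1 - 2 * w) ^ 2) = (β - γ) * (α - γ) / ((α - β) * (x - γ) ^ 2) *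
        √(l * ((α - x) * (x - β) * (x - γ) * (x - δ))) := by
    have hk : 0 < 1 - radialModulus α β γ δ * w := by
      obtain ⟨k0, k1⟩ := radialModulus_mem_Ioo hαβ hβγ hγδ
      nlinarith
    refine (pow_left_inj₀ (by positivity) (by positivity) two_ne_zero).1 ?_
    simp only [mul_pow, div_pow]
    rw [sq_sqrt hl.le, sq_sqrt h2.le, sq_sqrt h5.le, sq_sqrt hk.le, sq_sqrt hzz.le, sq_sqrt hR.le]
    have e1 : 1 - radialModulus α β γ δ * w = (β - γ) * (x - δ) / ((β - δ) * (x - γ)) := by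
      have h9 : δ - β ≠ 0 := by linarith
      rw [radialModulus, hwdef]
      field_simp
      ring
    have e2 : 1 - (1 - 2 * w) ^ 2 =
        4 * (x - β) * (α - γ) * (β - γ) * (α - x) / ((α - β) ^ 2 * (x - γ) ^ 2) := by
      rw [hwdef]
      field_simp
      ring
    rw [e1, e2]
    field_simp
    ring
  have hsz := (sqrt_pos.2 hzz).ne'
  have hsR := (sqrt_pos.2 hR).ne'
  rw [div_eq_iff hsR]
  have : -(1 / √(1 - (1 - 2 * w) ^ 2)) * -(2 * ((β - γ) * (α - γ) / ((α - β) * (x - γ) ^ 2))) / 2 =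
      (β - γ) * (α - γ) / ((α - β) * (x - γ) ^ 2) / √(1 - (1 - 2 * w) ^ 2) := by ring
  rw [this, div_mul_eq_mul_div _ (√(1 - (1 - 2 * w) ^ 2)), eq_div_iff hsz, key]

theorem continuous_comp_uniformRadius_div (hαβ : β < α) (hβγ : γ < β) (hγδ : δ < γ) {g : ℝ → ℝ}
    (hg : ContinuousOn g (Set.Icc β α)) : Continuous fun ψ =>
      g (uniformRadius α β γ ψ) / √(1 - radialModulus α β γ δ * sin ψ ^ 2) := by
  obtain ⟨k0, k1⟩ := radialModulus_mem_Ioo hαβ hβγ hγδ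
  refine Continuous.div (hg.comp_continuous (continuous_uniformRadius hαβ hβγ)
    (uniformRadius_mem_Icc hαβ hβγ)) (by fun_prop) fun ψ => ?_
  exact (sqrt_pos.2 (one_sub_mul_sin_sq_pos k0.le k1 ψ)).ne'

/-- The increment, along a monotone piece of the radial motion, of a quantity whose rate of change
is a function of the radius. -/
theorem sub_eq_integral_of_radial_motion (hαβ : β < α) (hβγ : γ < β) (hγδ : δ < γ) {l : ℝ}
    (hl : 0 < l) {ε p q : ℝ} (hε : ε ^ 2 = 1) (hpq : p < q) {x y m g : ℝ → ℝ}
    (hg : ContinuousOn g (Set.Icc β α))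
    (hx : ContinuousOn x (Set.Icc p q)) (hy : ContinuousOn y (Set.Icc p q))
    (hxI : ∀ s ∈ Set.Icc p q, x s ∈ Set.Icc β α) (hxO : ∀ s ∈ Set.Ioo p q, x s ∈ Set.Ioo β α)
    (hxd : ∀ s ∈ Set.Ioo p q, HasDerivAt x
      (ε * √(l * ((α - x s) * (x s - β) * (x s - γ) * (x s - δ))) / m s) s)
    (hyd : ∀ s ∈ Set.Ioo p q, HasDerivAt y (g (x s) / m s) s) :
    y q - y p = ε * (2 / (√l * √(α - γ) * √(β - δ)) *
      ∫ ψ in uniformAngle α β γ (x p)..uniformAngle α β γ (x q),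
        g (uniformRadius α β γ ψ) / √(1 - radialModulus α β γ δ * sin ψ ^ 2)) := by
  set h := fun ψ => g (uniformRadius α β γ ψ) / √(1 - radialModulus α β γ δ * sin ψ ^ 2) with hh
  have hhc : Continuous h := continuous_comp_uniformRadius_div hαβ hβγ hγδ hg
  set c := √l * √(α - γ) * √(β - δ) with hc
  have hc0 : c ≠ 0 := by
    have h2 : 0 < α - γ := by linarith
    have h5 : 0 < β - δ := by linarith
    positivity
  -- D is shown to be constant: its derivative vanishes inside the interval, where m cancels and ε²
  -- = 1. At the turning points, where the derivative formula for `uniformAngle` is unavailable, the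
  -- mean value theorem needs only continuity.
  set D := fun s => y s - ε * (2 / c * ∫ ψ in (0 : ℝ)..uniformAngle α β γ (x s), h ψ) with hD
  have hH : ∀ Ψ, HasDerivAt (fun Ψ => ∫ ψ in (0 : ℝ)..Ψ, h ψ) (h Ψ) Ψ := fun Ψ =>
    intervalIntegral.integral_hasDerivAt_right (hhc.intervalIntegrable _ _)
      (hhc.stronglyMeasurableAtFilter _ _) hhc.continuousAt
  have hcont : ContinuousOn D (Set.Icc p q) := by
    have h1 : ContinuousOn (fun s => uniformAngle α β γ (x s)) (Set.Icc p q) :=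
      (continuousOn_uniformAngle hαβ hβγ).comp hx hxI
    have h2 : Continuous fun Ψ => ∫ ψ in (0 : ℝ)..Ψ, h ψ :=
      continuous_iff_continuousAt.2 fun Ψ => (hH Ψ).continuousAt
    exact hy.sub (continuousOn_const.mul (continuousOn_const.mul (h2.comp_continuousOn h1)))
  have hder : ∀ s ∈ Set.Ioo p q, HasDerivAt D 0 s := by
    intro s hs
    have hxs := hxO s hs
    have h1 := (hasDerivAt_uniformAngle hαβ hβγ hγδ hl hxs).comp s (hxd s hs)
    have h2 := (hH _).comp s h1
    convert! (hyd s hs).sub ((h2.const_mul (2 / c)).const_mul ε) using 1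
    rw [← hc, hh]
    simp only [Function.comp_apply, uniformRadius_uniformAngle hαβ hβγ hxs]
    have hR : √(l * ((α - x s) * (x s - β) * (x s - γ) * (x s - δ))) ≠ 0 := by
      have h3 : 0 < α - x s := by linarith [hxs.2]
      have h4 : 0 < x s - β := by linarith [hxs.1]
      have h5 : 0 < x s - γ := by linarith
      have h6 : 0 < x s - δ := by linarith
      positivity
    obtain ⟨k0, k1⟩ := radialModulus_mem_Ioo hαβ hβγ hγδ
    have hk := (sqrt_pos.2 (one_sub_mul_sin_sq_pos k0.le k1 (uniformAngle α β γ (x s)))).ne'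
    set A := √(l * ((α - x s) * (x s - β) * (x s - γ) * (x s - δ)))
    set B := √(1 - radialModulus α β γ δ * sin (uniformAngle α β γ (x s)) ^ 2)
    have e : ε * (2 / c * (g (x s) / B * (c / 2 * B / A * (ε * A / m s)))) =
        ε ^ 2 * (g (x s) / m s) := by field_simp
    rw [e, hε]
    ring
  have hEq : D q = D p := by
    obtain ⟨ξ, hξ, he⟩ := exists_hasDerivAt_eq_slope D (fun _ => 0) hpq hcont hder
    have := (eq_div_iff (sub_ne_zero.2 hpq.ne')).1 he
    linarith
  have hsub := intervalIntegral.integral_add_adjacent_intervals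
    (hhc.intervalIntegrable (μ := MeasureTheory.volume) 0 (uniformAngle α β γ (x p)))
    (hhc.intervalIntegrable (uniformAngle α β γ (x p)) (uniformAngle α β γ (x q)))
  simp only [hD, ← hsub] at hEq
  linear_combination hEq

theorem integral_zero_pi_of_sin_sq {f : ℝ → ℝ} (hf : Continuous f)
    (hsymm : ∀ t, f (π - t) = f t) :
    ∫ t in (0 : ℝ)..π, f t = 2 * ∫ t in (0 : ℝ)..π / 2, f t := by
  have h1 := intervalIntegral.integral_add_adjacent_intervals
    (hf.intervalIntegrable (μ := MeasureTheory.volume) 0 (π / 2)) (hf.intervalIntegrable (π / 2) π)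
  have h2 := intervalIntegral.integral_comp_sub_left f (a := 0) (b := π / 2) π
  simp only [hsymm, sub_zero, sub_half] at h2
  rw [← h1, ← h2]
  ring

/-- The increment over a radial revolution. -/
theorem sub_eq_integral_of_revolution (hαβ : β < α) (hβγ : γ < β) (hγδ : δ < γ) {l : ℝ}
    (hl : 0 < l) {s₀ s₁ s₂ : ℝ} {x y m g : ℝ → ℝ} (hrev : IsRadialRevolution x β α s₀ s₁ s₂)
    (hg : ContinuousOn g (Set.Icc β α))
    (hm : ∀ s ∈ Set.Icc s₀ s₂, 0 < m s)
    (hx : ∀ s ∈ Set.Icc s₀ s₂, DifferentiableAt ℝ x s)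
    (hxd : ∀ s ∈ Set.Icc s₀ s₂, (m s * deriv x s) ^ 2 =
      l * ((α - x s) * (x s - β) * (x s - γ) * (x s - δ)))
    (hyd : ∀ s ∈ Set.Icc s₀ s₂, HasDerivAt y (g (x s) / m s) s) :
    y s₂ - y s₀ = 2 / (√l * √(α - γ) * √(β - δ)) * ∫ ψ in (0 : ℝ)..π,
        g (uniformRadius α β γ ψ) / √(1 - radialModulus α β γ δ * sin ψ ^ 2) := by
  have h01 := hrev.lt₀₁
  have h12 := hrev.lt₁₂
  have hsub1 : Set.Icc s₀ s₁ ⊆ Set.Icc s₀ s₂ := Set.Icc_subset_Icc_right h12.le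
  have hsub2 : Set.Icc s₁ s₂ ⊆ Set.Icc s₀ s₂ := Set.Icc_subset_Icc_left h01.le
  have hxc : ContinuousOn x (Set.Icc s₀ s₂) := fun s hs => (hx s hs).continuousAt.continuousWithinAt
  have hyc : ContinuousOn y (Set.Icc s₀ s₂) := fun s hs => (hyd s hs).continuousAt.continuousWithinAt
  have hx1 : ∀ s ∈ Set.Icc s₀ s₁, x s ∈ Set.Icc β α := fun s hs => by
    rw [← hrev.eq₀, ← hrev.eq₁]
    exact ⟨hrev.increasing.monotoneOn (Set.left_mem_Icc.2 h01.le) hs hs.1,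
      hrev.increasing.monotoneOn hs (Set.right_mem_Icc.2 h01.le) hs.2⟩
  have hx1' : ∀ s ∈ Set.Ioo s₀ s₁, x s ∈ Set.Ioo β α := fun s hs => by
    have hs' := Set.Ioo_subset_Icc_self hs
    rw [← hrev.eq₀, ← hrev.eq₁]
    exact ⟨hrev.increasing (Set.left_mem_Icc.2 h01.le) hs' hs.1,
      hrev.increasing hs' (Set.right_mem_Icc.2 h01.le) hs.2⟩
  have hx2 : ∀ s ∈ Set.Icc s₁ s₂, x s ∈ Set.Icc β α := fun s hs => by
    rw [← hrev.eq₂, ← hrev.eq₁]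
    exact ⟨hrev.decreasing.antitoneOn hs (Set.right_mem_Icc.2 h12.le) hs.2,
      hrev.decreasing.antitoneOn (Set.left_mem_Icc.2 h12.le) hs hs.1⟩
  have hx2' : ∀ s ∈ Set.Ioo s₁ s₂, x s ∈ Set.Ioo β α := fun s hs => by
    have hs' := Set.Ioo_subset_Icc_self hs
    rw [← hrev.eq₂, ← hrev.eq₁]
    exact ⟨hrev.decreasing hs' (Set.right_mem_Icc.2 h12.le) hs.2,
      hrev.decreasing (Set.left_mem_Icc.2 h12.le) hs' hs.1⟩
  have hd1 : ∀ s ∈ Set.Ioo s₀ s₁, HasDerivAt x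
      (1 * √(l * ((α - x s) * (x s - β) * (x s - γ) * (x s - δ))) / m s) s := fun s hs => by
    have hs' := hsub1 (Set.Ioo_subset_Icc_self hs)
    have hnhds := Icc_mem_nhds hs.1 hs.2
    -- Monotonicity selects the sign of the square root in the squared radial equation.
    have h0 : 0 ≤ deriv x s := by
      rw [← derivWithin_of_mem_nhds hnhds]
      exact hrev.increasing.monotoneOn.derivWithin_nonneg
    rw [← hxd s hs', sqrt_sq (mul_nonneg (hm s hs').le h0), one_mul,
      mul_div_cancel_left₀ _ (hm s hs').ne']
    exact (hx s hs').hasDerivAt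
  have hd2 : ∀ s ∈ Set.Ioo s₁ s₂, HasDerivAt x
      (-1 * √(l * ((α - x s) * (x s - β) * (x s - γ) * (x s - δ))) / m s) s := fun s hs => by
    have hs' := hsub2 (Set.Ioo_subset_Icc_self hs)
    have hnhds := Icc_mem_nhds hs.1 hs.2
    have h0 : deriv x s ≤ 0 := by
      rw [← derivWithin_of_mem_nhds hnhds]
      exact hrev.decreasing.antitoneOn.derivWithin_nonpos
    rw [← hxd s hs', sqrt_sq_eq_abs,
      abs_of_nonpos (mul_nonpos_of_nonneg_of_nonpos (hm s hs').le h0), neg_one_mul, neg_neg,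
      mul_div_cancel_left₀ _ (hm s hs').ne']
    exact (hx s hs').hasDerivAt
  have e1 := sub_eq_integral_of_radial_motion hαβ hβγ hγδ hl (one_pow 2) h01 hg (hxc.mono hsub1)
    (hyc.mono hsub1) hx1 hx1' hd1 fun s hs => hyd s (hsub1 (Set.Ioo_subset_Icc_self hs))
  have e2 := sub_eq_integral_of_radial_motion hαβ hβγ hγδ hl (ε := -1) (by norm_num) h12 hg
    (hxc.mono hsub2) (hyc.mono hsub2) hx2 hx2' hd2
    fun s hs => hyd s (hsub2 (Set.Ioo_subset_Icc_self hs))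
  -- On the way in, ε = -1 and the reversed limits compensate, so each half contributes the same
  -- integral over [0, π/2]; the symmetry ψ ↦ π - ψ merges the two into [0, π].
  rw [hrev.eq₀, hrev.eq₁, uniformAngle_left, uniformAngle_right hαβ hβγ] at e1
  rw [hrev.eq₁, hrev.eq₂, uniformAngle_left, uniformAngle_right hαβ hβγ,
    intervalIntegral.integral_symm] at e2
  rw [integral_zero_pi_of_sin_sq (continuous_comp_uniformRadius_div hαβ hβγ hγδ hg)
    fun t => by simp only [uniformRadius, sin_pi_sub]]
  linear_combination e1 + e2

end

/-! ### Factorisation of the radial quartic and position of the horizons. -/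

section Quartic

/-- Successive divided differences at the four distinct nodes kill the coefficients from the top
down. -/
theorem eq_zero_of_cubic {c₀ c₁ c₂ c₃ α β γ δ : ℝ} (hαβ : β ≠ α) (hαγ : γ ≠ α) (hαδ : δ ≠ α)
    (hβγ : γ ≠ β) (hβδ : δ ≠ β) (hγδ : δ ≠ γ) (hα : c₃ * α ^ 3 + c₂ * α ^ 2 + c₁ * α + c₀ = 0)
    (hβ : c₃ * β ^ 3 + c₂ * β ^ 2 + c₁ * β + c₀ = 0)
    (hγ : c₃ * γ ^ 3 + c₂ * γ ^ 2 + c₁ * γ + c₀ = 0)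
    (hδ : c₃ * δ ^ 3 + c₂ * δ ^ 2 + c₁ * δ + c₀ = 0) (x : ℝ) :
    c₃ * x ^ 3 + c₂ * x ^ 2 + c₁ * x + c₀ = 0 := by
  have h1 : ∀ y, y ≠ α → c₃ * y ^ 3 + c₂ * y ^ 2 + c₁ * y + c₀ = 0 →
      c₃ * (y ^ 2 + y * α + α ^ 2) + c₂ * (y + α) + c₁ = 0 := fun y hy h =>
    mul_left_cancel₀ (sub_ne_zero.2 hy) (by linear_combination h - hα)
  have h2 : ∀ y, y ≠ α → y ≠ β → c₃ * y ^ 3 + c₂ * y ^ 2 + c₁ * y + c₀ = 0 →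
      c₃ * (y + α + β) + c₂ = 0 := fun y hy hy' h =>
    mul_left_cancel₀ (sub_ne_zero.2 hy') (by linear_combination h1 y hy h - h1 β hαβ hβ)
  have h3 : c₃ = 0 := mul_left_cancel₀ (sub_ne_zero.2 hγδ)
    (by linear_combination h2 δ hαδ hβδ hδ - h2 γ hαγ hβγ hγ)
  have h4 : c₂ = 0 := by linear_combination h2 γ hαγ hβγ hγ - (γ + α + β) * h3
  have h5 : c₁ = 0 := by
    linear_combination h1 β hαβ hβ - (β + α) * h4 - (β ^ 2 + β * α + α ^ 2) * h3
  have h6 : c₀ = 0 := by linear_combination hα - α ^ 3 * h3 - α ^ 2 * h4 - α * h5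
  simp [h3, h4, h5, h6]

variable {a e E Q α β γ δ : ℝ}

theorem radialPoly_eq_of_roots (hαβ : β < α) (hβγ : γ < β) (hγδ : δ < γ)
    (hα : radialPoly 1 a e E Q α = 0) (hβ : radialPoly 1 a e E Q β = 0)
    (hγ : radialPoly 1 a e E Q γ = 0) (hδ : radialPoly 1 a e E Q δ = 0) (x : ℝ) :
    radialPoly 1 a e E Q x = (1 - E ^ 2) * ((α - x) * (x - β) * (x - γ) * (x - δ)) := by
  simp only [radialPoly, Delta] at *
  -- The quartic and the product share the leading coefficient -(1 - E²), so their difference is the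
  -- cubic with these coefficients.
  have h := eq_zero_of_cubic
    (c₃ := 2 - (1 - E ^ 2) * (α + β + γ + δ))
    (c₂ := 2 * a ^ 2 * E ^ 2 - (Q + a ^ 2 * E ^ 2 + a ^ 2 + e ^ 2) +
      (1 - E ^ 2) * (α * β + α * γ + α * δ + β * γ + β * δ + γ * δ))
    (c₁ := 2 * (Q + a ^ 2 * E ^ 2) -
      (1 - E ^ 2) * (α * β * γ + α * β * δ + α * γ * δ + β * γ * δ))
    (c₀ := a ^ 4 * E ^ 2 - (a ^ 2 + e ^ 2) * (Q + a ^ 2 * E ^ 2) + (1 - E ^ 2) * (α * β * γ * δ))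
    hαβ.ne (hβγ.trans hαβ).ne (hγδ.trans (hβγ.trans hαβ)).ne hβγ.ne (hγδ.trans hβγ).ne hγδ.ne
    (by linear_combination hα) (by linear_combination hβ) (by linear_combination hγ)
    (by linear_combination hδ) x
  linear_combination h

/-- At a zero of Δ the quartic equals the positive square ((x² + a²)E)², whereas its factorisation
makes it nonpositive on [γ, β). -/
theorem lt_of_Delta_eq_zero (ha : a ≠ 0) (hE : E ^ 2 < 1) (hE0 : E ≠ 0) (hαβ : β < α)
    (hγδ : δ < γ)
    (hR : ∀ x, radialPoly 1 a e E Q x = (1 - E ^ 2) * ((α - x) * (x - β) * (x - γ) * (x - δ)))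
    {x : ℝ} (hx : Delta 1 a e x = 0) (hxβ : x < β) : x < γ := by
  by_contra! h
  have h1 := hR x
  rw [radialPoly, hx, zero_mul, sub_zero] at h1
  have h2 : 0 < ((x ^ 2 + a ^ 2) * E) ^ 2 := by positivity
  have h3 : 0 ≤ (1 - E ^ 2) * ((α - x) * (β - x) * (x - γ) * (x - δ)) := by
    have := sub_pos.2 hE
    have : 0 < α - x := by linarith
    have : 0 < β - x := by linarith
    have : 0 ≤ x - γ := by linarith
    have : 0 ≤ x - δ := by linarith
    positivity
  linarith

end Quartic

/-! ### Complete radial integrals in terms of F₁. -/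

section RadialIntegrals

variable {α β γ δ : ℝ}

theorem integral_sin_pow_div_eq_appellF1 (p n : ℕ) {x y : ℝ} (hx : |x| < 1) (hy : |y| < 1) :
    ∫ t in (0 : ℝ)..π, sin t ^ (2 * p) / ((1 - x * sin t ^ 2) ^ n * √(1 - y * sin t ^ 2)) =
      (∫ t in (0 : ℝ)..π, sin t ^ (2 * p)) * appellF1 (p + 1 / 2) n (1 / 2) (p + 1) x y := by
  rw [← integral_sin_pow_mul_eq_appellF1 p hx hy]
  refine intervalIntegral.integral_congr fun t _ => ?_
  have hpos : ∀ z : ℝ, |z| < 1 → 0 < 1 - z * sin t ^ 2 := fun z hz => by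
    have h1 := mul_le_mul_of_nonneg_right (le_abs_self z) (sq_nonneg (sin t))
    have h2 := mul_le_of_le_one_right (abs_nonneg z) (sin_sq_le_one t)
    linarith
  simp only [rpow_neg (hpos x hx).le, rpow_neg (hpos y hy).le, rpow_natCast, ← sqrt_eq_rpow]
  rw [← mul_inv, div_eq_mul_inv]

theorem integral_sin_pow_two_mul (p : ℕ) : ∫ t in (0 : ℝ)..π, sin t ^ (2 * p) =
    π * ∏ i ∈ Finset.range p, (2 * (i : ℝ) + 1) / (2 * i + 2) :=
  integral_sin_pow_even p

theorem continuous_sin_pow_div (p n : ℕ) {x y : ℝ} (hx : x ∈ Set.Ioo (0 : ℝ) 1)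
    (hy : y ∈ Set.Ioo (0 : ℝ) 1) :
    Continuous fun t => sin t ^ (2 * p) / ((1 - x * sin t ^ 2) ^ n * √(1 - y * sin t ^ 2)) :=
  Continuous.div (by fun_prop) (by fun_prop) fun t =>
    (mul_pos (pow_pos (one_sub_mul_sin_sq_pos hx.1.le hx.2 t) n)
      (sqrt_pos.2 (one_sub_mul_sin_sq_pos hy.1.le hy.2 t))).ne'

theorem abs_lt_one_of_mem_Ioo {x : ℝ} (hx : x ∈ Set.Ioo (0 : ℝ) 1) : |x| < 1 := by
  rw [abs_of_pos hx.1]; exact hx.2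

theorem integral_one_radial (hαβ : β < α) (hβγ : γ < β) (hγδ : δ < γ) :
    ∫ ψ in (0 : ℝ)..π, 1 / √(1 - radialModulus α β γ δ * sin ψ ^ 2) =
      π * ordinaryHypergeometric (1 / 2 : ℝ) (1 / 2 : ℝ) (1 : ℝ) (radialModulus α β γ δ) := by
  have hk := radialModulus_mem_Ioo hαβ hβγ hγδ
  rw [← integral_eq_ordinaryHypergeometric (abs_lt_one_of_mem_Ioo hk)]
  refine intervalIntegral.integral_congr fun t _ => ?_
  simp only [rpow_neg (one_sub_mul_sin_sq_pos hk.1.le hk.2 t).le, ← sqrt_eq_rpow]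
  rw [one_div]

theorem integral_radius (hαβ : β < α) (hβγ : γ < β) (hγδ : δ < γ) :
    ∫ ψ in (0 : ℝ)..π, uniformRadius α β γ ψ / √(1 - radialModulus α β γ δ * sin ψ ^ 2) =
      β * π * appellF1 (1 / 2) 1 (1 / 2) 1 ((α - β) / (α - γ)) (radialModulus α β γ δ) -
        γ * ((α - β) / (α - γ)) * (π / 2) *
          appellF1 (3 / 2) 1 (1 / 2) 2 ((α - β) / (α - γ)) (radialModulus α β γ δ) := by
  have hω := ratio_mem_Ioo hαβ hβγ
  have hk := radialModulus_mem_Ioo hαβ hβγ hγδ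
  have hω' := abs_lt_one_of_mem_Ioo hω
  have hk' := abs_lt_one_of_mem_Ioo hk
  have h0 := integral_sin_pow_div_eq_appellF1 0 1 hω' hk'
  have h1 := integral_sin_pow_div_eq_appellF1 1 1 hω' hk'
  have c0 := (continuous_sin_pow_div 0 1 hω hk).intervalIntegrable
    (μ := MeasureTheory.volume) 0 π
  have c1 := (continuous_sin_pow_div 1 1 hω hk).intervalIntegrable
    (μ := MeasureTheory.volume) 0 π
  rw [integral_sin_pow_two_mul] at h0 h1
  norm_num [Finset.prod_range_succ, -one_div] at h0 h1
  set ω := (α - β) / (α - γ)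
  set k := radialModulus α β γ δ
  have e : ∀ ψ, uniformRadius α β γ ψ / √(1 - k * sin ψ ^ 2) =
      β * (sin ψ ^ (2 * 0) / ((1 - ω * sin ψ ^ 2) ^ 1 * √(1 - k * sin ψ ^ 2))) -
      γ * ω * (sin ψ ^ (2 * 1) / ((1 - ω * sin ψ ^ 2) ^ 1 * √(1 - k * sin ψ ^ 2))) := fun ψ => by
    have hp := (one_sub_mul_sin_sq_pos hω.1.le hω.2 ψ).ne'
    have hq := (sqrt_pos.2 (one_sub_mul_sin_sq_pos hk.1.le hk.2 ψ)).ne'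
    rw [uniformRadius]
    field_simp
    ring
  simp only [e]
  rw [intervalIntegral.integral_sub (c0.const_mul _) (c1.const_mul _),
    intervalIntegral.integral_const_mul, intervalIntegral.integral_const_mul]
  simp only [mul_zero, pow_zero, pow_one, mul_one] at h0 h1 ⊢
  rw [h0, h1]
  ring

theorem integral_radius_sq (hαβ : β < α) (hβγ : γ < β) (hγδ : δ < γ) :
    ∫ ψ in (0 : ℝ)..π, uniformRadius α β γ ψ ^ 2 / √(1 - radialModulus α β γ δ * sin ψ ^ 2) =
      β ^ 2 * π * appellF1 (1 / 2) 2 (1 / 2) 1 ((α - β) / (α - γ)) (radialModulus α β γ δ) -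
        2 * β * γ * ((α - β) / (α - γ)) * (π / 2) *
          appellF1 (3 / 2) 2 (1 / 2) 2 ((α - β) / (α - γ)) (radialModulus α β γ δ) +
        γ ^ 2 * ((α - β) / (α - γ)) ^ 2 * (3 * π / 8) *
          appellF1 (5 / 2) 2 (1 / 2) 3 ((α - β) / (α - γ)) (radialModulus α β γ δ) := by
  have hω := ratio_mem_Ioo hαβ hβγ
  have hk := radialModulus_mem_Ioo hαβ hβγ hγδ
  have hω' := abs_lt_one_of_mem_Ioo hω
  have hk' := abs_lt_one_of_mem_Ioo hk
  have h0 := integral_sin_pow_div_eq_appellF1 0 2 hω' hk'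
  have h1 := integral_sin_pow_div_eq_appellF1 1 2 hω' hk'
  have h2 := integral_sin_pow_div_eq_appellF1 2 2 hω' hk'
  have c0 := (continuous_sin_pow_div 0 2 hω hk).intervalIntegrable
    (μ := MeasureTheory.volume) 0 π
  have c1 := (continuous_sin_pow_div 1 2 hω hk).intervalIntegrable
    (μ := MeasureTheory.volume) 0 π
  have c2 := (continuous_sin_pow_div 2 2 hω hk).intervalIntegrable
    (μ := MeasureTheory.volume) 0 π
  rw [integral_sin_pow_two_mul] at h0 h1 h2
  norm_num [Finset.prod_range_succ] at h0 h1 h2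
  set ω := (α - β) / (α - γ)
  set k := radialModulus α β γ δ
  have e : ∀ ψ, uniformRadius α β γ ψ ^ 2 / √(1 - k * sin ψ ^ 2) =
      β ^ 2 * (sin ψ ^ (2 * 0) / ((1 - ω * sin ψ ^ 2) ^ 2 * √(1 - k * sin ψ ^ 2))) -
      2 * β * γ * ω * (sin ψ ^ (2 * 1) / ((1 - ω * sin ψ ^ 2) ^ 2 * √(1 - k * sin ψ ^ 2))) +
      γ ^ 2 * ω ^ 2 * (sin ψ ^ (2 * 2) / ((1 - ω * sin ψ ^ 2) ^ 2 * √(1 - k * sin ψ ^ 2))) :=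
    fun ψ => by
      have hp := (one_sub_mul_sin_sq_pos hω.1.le hω.2 ψ).ne'
      have hq := (sqrt_pos.2 (one_sub_mul_sin_sq_pos hk.1.le hk.2 ψ)).ne'
      rw [uniformRadius]
      field_simp
      ring
  simp only [e]
  rw [intervalIntegral.integral_add ((c0.const_mul _).sub (c1.const_mul _)) (c2.const_mul _),
    intervalIntegral.integral_sub (c0.const_mul _) (c1.const_mul _),
    intervalIntegral.integral_const_mul, intervalIntegral.integral_const_mul,
    intervalIntegral.integral_const_mul]
  norm_num
  rw [h0, h1, h2]
  ring

theorem integral_inv_radius_sub (hαβ : β < α) (hβγ : γ < β) (hγδ : δ < γ) {x : ℝ} (hx : x < γ) :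
    ∫ ψ in (0 : ℝ)..π, (uniformRadius α β γ ψ - x)⁻¹ /
        √(1 - radialModulus α β γ δ * sin ψ ^ 2) =
      1 / (β - x) * (π * appellF1 (1 / 2) 1 (1 / 2) 1
        ((α - β) / (α - γ) * ((x - γ) / (x - β))) (radialModulus α β γ δ) -
        (α - β) / (α - γ) * (π / 2) * appellF1 (3 / 2) 1 (1 / 2) 2
          ((α - β) / (α - γ) * ((x - γ) / (x - β))) (radialModulus α β γ δ)) := by
  have hω := ratio_mem_Ioo hαβ hβγ
  have hk := radialModulus_mem_Ioo hαβ hβγ hγδ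
  have hκ := mul_ratio_mem_Ioo hω hx hβγ
  have hκ' := abs_lt_one_of_mem_Ioo hκ
  have hk' := abs_lt_one_of_mem_Ioo hk
  have h0 := integral_sin_pow_div_eq_appellF1 0 1 hκ' hk'
  have h1 := integral_sin_pow_div_eq_appellF1 1 1 hκ' hk'
  have c0 := (continuous_sin_pow_div 0 1 hκ hk).intervalIntegrable
    (μ := MeasureTheory.volume) 0 π
  have c1 := (continuous_sin_pow_div 1 1 hκ hk).intervalIntegrable
    (μ := MeasureTheory.volume) 0 π
  rw [integral_sin_pow_two_mul] at h0 h1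
  norm_num [Finset.prod_range_succ, -one_div] at h0 h1
  -- This relation defines κ±²: it makes r - x equal to (β - x)(1 - κ±² sin²ψ)/(1 - ω sin²ψ), so its
  -- inverse has a single new pole factor.
  have hκe : (β - x) * ((α - β) / (α - γ) * ((x - γ) / (x - β))) =
      (α - β) / (α - γ) * (γ - x) := by
    have : x - β ≠ 0 := by linarith
    field_simp
    ring
  set ω := (α - β) / (α - γ)
  set k := radialModulus α β γ δ
  set κ := ω * ((x - γ) / (x - β))
  have e : ∀ ψ, (uniformRadius α β γ ψ - x)⁻¹ / √(1 - k * sin ψ ^ 2) =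
      1 / (β - x) * ((sin ψ ^ (2 * 0) / ((1 - κ * sin ψ ^ 2) ^ 1 * √(1 - k * sin ψ ^ 2))) -
      ω * (sin ψ ^ (2 * 1) / ((1 - κ * sin ψ ^ 2) ^ 1 * √(1 - k * sin ψ ^ 2)))) := fun ψ => by
    have hp := (one_sub_mul_sin_sq_pos hω.1.le hω.2 ψ).ne'
    have hr := (one_sub_mul_sin_sq_pos hκ.1.le hκ.2 ψ).ne'
    have hq := (sqrt_pos.2 (one_sub_mul_sin_sq_pos hk.1.le hk.2 ψ)).ne'
    have hb : β - x ≠ 0 := by linarith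
    have e1 : uniformRadius α β γ ψ - x =
        (β - x) * (1 - κ * sin ψ ^ 2) / (1 - ω * sin ψ ^ 2) := by
      rw [uniformRadius, eq_div_iff hp, sub_mul, div_mul_cancel₀ _ hp]
      linear_combination sin ψ ^ 2 * hκe
    rw [e1]
    field_simp
    ring_nf
  simp only [e]
  rw [intervalIntegral.integral_const_mul, intervalIntegral.integral_sub c0 (c1.const_mul _),
    intervalIntegral.integral_const_mul]
  simp only [mul_zero, pow_zero, pow_one, mul_one] at h0 h1 ⊢
  rw [h0, h1]
  ring

end RadialIntegrals

/-! ### The polar motion and its elliptic integrals. -/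

section PolarMotion

/-- Ψ is ±(θ - θ(s₀)), with the sign making it increase. Starting in the equatorial plane shifts θ
by a quarter turn, exchanging sine and cosine up to sign, and the potential becomes Q(1 - κ'²
sin²Ψ). -/
theorem exists_polar_angle {a E Q s₀ s₂ : ℝ} {θ m : ℝ → ℝ} (hE : E ^ 2 < 1)
    (hQ : a ^ 2 * (1 - E ^ 2) < Q) (hm : ∀ s ∈ Set.Icc s₀ s₂, 0 < m s)
    (hθ : ∀ s ∈ Set.Icc s₀ s₂, DifferentiableAt ℝ θ s)
    (hpol : ∀ s ∈ Set.Icc s₀ s₂, (m s * deriv θ s) ^ 2 = polarPotential a E Q (θ s))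
    (heq : cos (θ s₀) = 0) :
    ∃ Ψ : ℝ → ℝ, Ψ s₀ = 0 ∧ (∀ s, sin (θ s) ^ 2 = cos (Ψ s) ^ 2) ∧
      ∀ s ∈ Set.Icc s₀ s₂,
        HasDerivAt Ψ (√Q * √(1 - a ^ 2 * (1 - E ^ 2) / Q * sin (Ψ s) ^ 2) / m s) s := by
  have hQ0 : 0 < Q := (mul_nonneg (sq_nonneg a) (sub_pos.2 hE).le).trans_lt hQ
  have hcos : ∀ σ : ℝ, σ = 1 ∨ σ = -1 → ∀ s, sin (θ s) ^ 2 = cos (σ * (θ s - θ s₀)) ^ 2 := by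
    intro σ hσ s
    have h1 : cos (σ * (θ s - θ s₀)) = cos (θ s - θ s₀) := by
      rcases hσ with rfl | rfl <;> simp [← cos_neg (θ s - θ s₀)]
    have h2 : sin (θ s₀) ^ 2 = 1 := by nlinarith [sin_sq_add_cos_sq (θ s₀)]
    rw [h1, cos_sub, heq, mul_zero, zero_add, mul_pow, h2, mul_one]
  have hpos : ∀ s, 0 < polarPotential a E Q (θ s) := fun s => by
    rw [polarPotential]
    nlinarith [cos_sq_le_one (θ s), sq_nonneg (cos (θ s)),
      mul_nonneg (sq_nonneg a) (sub_pos.2 hE).le]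
  have hfinal : ∀ σ : ℝ, σ = 1 ∨ σ = -1 → (∀ s ∈ Set.Icc s₀ s₂, 0 < σ * deriv θ s) →
      ∀ s ∈ Set.Icc s₀ s₂, HasDerivAt (fun s => σ * (θ s - θ s₀))
        (√Q * √(1 - a ^ 2 * (1 - E ^ 2) / Q * sin (σ * (θ s - θ s₀)) ^ 2) / m s) s := by
    intro σ hσ hd s hs
    have hσ2 : σ ^ 2 = 1 := by rcases hσ with rfl | rfl <;> norm_num
    have h1 : √Q * √(1 - a ^ 2 * (1 - E ^ 2) / Q * sin (σ * (θ s - θ s₀)) ^ 2) =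
        m s * (σ * deriv θ s) := by
      rw [← sqrt_mul hQ0.le, sin_sq (σ * (θ s - θ s₀)), ← hcos σ hσ s,
        ← sqrt_sq (mul_nonneg (hm s hs).le (hd s hs).le)]
      congr 1
      have h2 := hpol s hs
      rw [polarPotential, cos_sq'] at h2
      field_simp
      linear_combination -h2 - m s ^ 2 * deriv θ s ^ 2 * hσ2
    rw [h1, mul_div_cancel_left₀ _ (hm s hs).ne']
    exact ((hθ s hs).hasDerivAt.sub_const (θ s₀)).const_mul σ
  have hne : ∀ s ∈ Set.Icc s₀ s₂, deriv θ s ≠ 0 := fun s hs h => by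
    have := hpol s hs
    rw [h, mul_zero] at this
    linarith [hpos s]
  -- Darboux's theorem: a derivative without zeros on an interval keeps its sign, even if it is not
  -- known to be continuous.
  rcases hasDerivWithinAt_forall_lt_or_forall_gt_of_forall_ne (convex_Icc s₀ s₂)
    (fun s hs => (hθ s hs).hasDerivAt.hasDerivWithinAt) hne with h | h
  · exact ⟨_, by simp, hcos (-1) (.inr rfl),
      hfinal (-1) (.inr rfl) fun s hs => by linarith [h s hs]⟩
  · exact ⟨_, by simp, hcos 1 (.inl rfl), hfinal 1 (.inl rfl) fun s hs => by linarith [h s hs]⟩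

theorem jacobiAm_integral {k : ℝ} (hk : 0 ≤ k) (hk1 : k < 1) (Ψ : ℝ) :
    jacobiAm (∫ ψ in (0 : ℝ)..Ψ, 1 / √(1 - k * sin ψ ^ 2)) k = Ψ := by
  have hpos : ∀ t : ℝ, 0 < 1 / √(1 - k * sin t ^ 2) := fun t =>
    one_div_pos.2 (sqrt_pos.2 (one_sub_mul_sin_sq_pos hk hk1 t))
  have hc : Continuous fun t : ℝ => 1 / √(1 - k * sin t ^ 2) :=
    continuous_const.div (by fun_prop) fun t =>
      (sqrt_pos.2 (one_sub_mul_sin_sq_pos hk hk1 t)).ne'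
  have hmono : StrictMono fun Ψ : ℝ => ∫ ψ in (0 : ℝ)..Ψ, 1 / √(1 - k * sin ψ ^ 2) :=
    strictMono_of_deriv_pos fun x => by
      rw [hc.deriv_integral]; exact hpos x
  exact Function.leftInverse_invFun hmono.injective Ψ

/-- Rests on k cos²ψ = (k - 1) + (1 - k sin²ψ), which splits the integrand into first and second
kind. -/
theorem integral_cos_sq_div_eq {k : ℝ} (hk : 0 < k) (hk1 : k < 1) (Ψ : ℝ) :
    ∫ ψ in (0 : ℝ)..Ψ, cos ψ ^ 2 / √(1 - k * sin ψ ^ 2) =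
      (∫ ψ in (0 : ℝ)..Ψ, (1 - k * sin ψ ^ 2) ^ (-(1 / 2) : ℝ)) +
        (-(∫ ψ in (0 : ℝ)..Ψ, (1 - k * sin ψ ^ 2) ^ (-(1 / 2) : ℝ)) +
          ∫ ψ in (0 : ℝ)..Ψ, (1 - k * sin ψ ^ 2) ^ (-(-1 / 2) : ℝ)) * (1 / k) := by
  have hpos : ∀ t : ℝ, 0 < 1 - k * sin t ^ 2 := one_sub_mul_sin_sq_pos hk.le hk1
  have hint : ∀ b : ℝ, IntervalIntegrable (fun ψ : ℝ => (1 - k * sin ψ ^ 2) ^ b)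
      MeasureTheory.volume 0 Ψ := fun b =>
    ((by fun_prop : Continuous fun t : ℝ => 1 - k * sin t ^ 2).rpow_const
      fun t => Or.inl (hpos t).ne').intervalIntegrable _ _
  rw [neg_add_eq_sub, ← intervalIntegral.integral_sub (hint _) (hint _),
    ← intervalIntegral.integral_mul_const,
    ← intervalIntegral.integral_add (hint _) (((hint _).sub (hint _)).mul_const _)]
  refine intervalIntegral.integral_congr fun t _ => ?_
  have h := hpos t
  have hs := sqrt_pos.2 h
  have hs2 := sq_sqrt h.le
  have e : (-(-1 / 2) : ℝ) = 1 / 2 := by norm_num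
  simp only [e, rpow_neg h.le, ← sqrt_eq_rpow]
  have h3 : k * cos t ^ 2 = k - 1 + √(1 - k * sin t ^ 2) ^ 2 := by
    rw [hs2]; linear_combination k * sin_sq_add_cos_sq t
  field_simp
  linear_combination h3

end PolarMotion

/-! ### Scaling to dimensionless form and the time of a revolution. -/

theorem radialPoly_scale (m a e E Q x : ℝ) :
    radialPoly m (a * m) (e * m) E (Q * m ^ 2) (x * m) = m ^ 4 * radialPoly 1 a e E Q x := by
  simp only [radialPoly, Delta]
  ring

theorem polarPotential_scale (m a E Q θ : ℝ) :
    polarPotential (a * m) E (Q * m ^ 2) θ = m ^ 2 * polarPotential a E Q θ := by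
  simp only [polarPotential]
  ring

theorem Delta_scale (m a e x : ℝ) : Delta m (a * m) (e * m) (x * m) = m ^ 2 * Delta 1 a e x := by
  simp only [Delta]
  ring

/-- The coordinate time of a radial revolution in units of the gravitational radius: the polar
angle reached, and the radial and polar contributions. -/
theorem exists_time_of_revolution {c m a e E Q α β γ δ s₀ s₁ s₂ : ℝ} {t r θ ϕ : ℝ → ℝ}
    (hm : 0 < m) (ha : a ≠ 0) (hE : E ^ 2 < 1) (hQ : a ^ 2 * (1 - E ^ 2) < Q)
    (hαβ : β < α) (hβγ : γ < β) (hγδ : δ < γ) (hβ0 : 0 < β)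
    (hR : ∀ x, radialPoly 1 a e E Q x = (1 - E ^ 2) * ((α - x) * (x - β) * (x - γ) * (x - δ)))
    (hΔ : ∀ x, β ≤ x → 0 < Delta 1 a e x)
    (hgeo : IsPolarGeodesicOn c m (a * m) (e * m) E (Q * m ^ 2) (Set.Icc s₀ s₂) t r θ ϕ)
    (hrev : IsRadialRevolution r (β * m) (α * m) s₀ s₁ s₂) (hequator : cos (θ s₀) = 0) :
    ∃ Ψ : ℝ, ∫ ψ in (0 : ℝ)..Ψ, 1 / √(1 - a ^ 2 * (1 - E ^ 2) / Q * sin ψ ^ 2) =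
        √Q * (2 / (√(1 - E ^ 2) * √(α - γ) * √(β - δ)) *
          ∫ ψ in (0 : ℝ)..π, 1 / √(1 - radialModulus α β γ δ * sin ψ ^ 2)) ∧
      c * (t s₂ - t s₀) = m * (2 / (√(1 - E ^ 2) * √(α - γ) * √(β - δ)) *
          (∫ ψ in (0 : ℝ)..π, (uniformRadius α β γ ψ ^ 2 + a ^ 2) ^ 2 * E /
            Delta 1 a e (uniformRadius α β γ ψ) / √(1 - radialModulus α β γ δ * sin ψ ^ 2)) -
        a ^ 2 * E / √Q *
          ∫ ψ in (0 : ℝ)..Ψ, cos ψ ^ 2 / √(1 - a ^ 2 * (1 - E ^ 2) / Q * sin ψ ^ 2)) := by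
  have hl : 0 < 1 - E ^ 2 := sub_pos.2 hE
  have hQ0 : 0 < Q := (mul_nonneg (sq_nonneg a) hl.le).trans_lt hQ
  have hk0 : 0 ≤ a ^ 2 * (1 - E ^ 2) / Q := by positivity
  have hk1 : a ^ 2 * (1 - E ^ 2) / Q < 1 := (div_lt_one hQ0).2 hQ
  have hsQ := (sqrt_pos.2 hQ0).ne'
  have hm0 := hm.ne'
  -- Both r and ρ² are divided by a single power of m: then w · dx/ds squares exactly to the
  -- dimensionless quartic, with the parameter s left unscaled.
  set x := fun s => r s / m with hx
  set w := fun s => rhoSq (a * m) (r s) (θ s) / m with hw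
  have hrx : ∀ s, r s = x s * m := fun s => (div_mul_cancel₀ _ hm0).symm
  have hrw : ∀ s, rhoSq (a * m) (r s) (θ s) = w s * m := fun s => (div_mul_cancel₀ _ hm0).symm
  have hrevx : IsRadialRevolution x β α s₀ s₁ s₂ :=
    ⟨hrev.lt₀₁, hrev.lt₁₂, by simp [hx, hrev.eq₀, hm0], by simp [hx, hrev.eq₁, hm0],
      by simp [hx, hrev.eq₂, hm0],
      fun p hp q hq h => div_lt_div_of_pos_right (hrev.increasing hp hq h) hm,
      fun p hp q hq h => div_lt_div_of_pos_right (hrev.decreasing hp hq h) hm⟩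
  have hxβ : ∀ s ∈ Set.Icc s₀ s₂, β ≤ x s := fun s hs => by
    rcases le_total s s₁ with h | h
    · rw [← hrevx.eq₀]
      exact hrevx.increasing.monotoneOn (Set.left_mem_Icc.2 hrev.lt₀₁.le) ⟨hs.1, h⟩ hs.1
    · rw [← hrevx.eq₂]
      exact hrevx.decreasing.antitoneOn ⟨h, hs.2⟩ (Set.right_mem_Icc.2 hrev.lt₁₂.le) hs.2
  have hwpos : ∀ s ∈ Set.Icc s₀ s₂, 0 < w s := fun s hs => by
    have h1 : 0 < r s := by rw [hrx]; exact mul_pos (hβ0.trans_le (hxβ s hs)) hm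
    have h2 : 0 < rhoSq (a * m) (r s) (θ s) := by rw [rhoSq]; positivity
    exact div_pos h2 hm
  have hderx : ∀ s, deriv x s = deriv r s / m := fun s => deriv_div_const ..
  have hxdiff : ∀ s ∈ Set.Icc s₀ s₂, DifferentiableAt ℝ x s := fun s hs =>
    (hgeo.differentiableAt_r s hs).div_const m
  have hxeq : ∀ s ∈ Set.Icc s₀ s₂, (w s * deriv x s) ^ 2 =
      (1 - E ^ 2) * ((α - x s) * (x s - β) * (x s - γ) * (x s - δ)) := fun s hs => by
    have h := hgeo.radial_eq s hs
    rw [hrw, hrx, radialPoly_scale, hR] at h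
    rw [hderx]
    refine mul_left_cancel₀ (pow_ne_zero 4 hm0) ?_
    rw [← h]
    field_simp
  obtain ⟨Ψ, hΨ0, hΨsin, hΨ⟩ := exists_polar_angle hE hQ hwpos hgeo.differentiableAt_θ
    (fun s hs => by
      have h := hgeo.polar_eq s hs
      rw [hrw, polarPotential_scale] at h
      refine mul_left_cancel₀ (pow_ne_zero 2 hm0) ?_
      rw [← h]
      ring) hequator
  have hpos : ∀ ψ : ℝ, 0 < √(1 - a ^ 2 * (1 - E ^ 2) / Q * sin ψ ^ 2) := fun ψ =>
    sqrt_pos.2 (one_sub_mul_sin_sq_pos hk0 hk1 ψ)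
  have hprim : ∀ {f : ℝ → ℝ}, Continuous f → ∀ s ∈ Set.Icc s₀ s₂, HasDerivAt
      (fun s => ∫ ψ in (0 : ℝ)..Ψ s, f ψ / √(1 - a ^ 2 * (1 - E ^ 2) / Q * sin ψ ^ 2))
      (√Q * f (Ψ s) / w s) s := by
    intro f hf s hs
    have hc : Continuous fun ψ : ℝ => f ψ / √(1 - a ^ 2 * (1 - E ^ 2) / Q * sin ψ ^ 2) :=
      hf.div (by fun_prop) fun ψ => (hpos ψ).ne'
    have h := (intervalIntegral.integral_hasDerivAt_right (hc.intervalIntegrable 0 (Ψ s))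
      (hc.stronglyMeasurableAtFilter _ _) hc.continuousAt).comp s (hΨ s hs)
    convert! h using 1
    have hz := (hpos (Ψ s)).ne'
    generalize √(1 - a ^ 2 * (1 - E ^ 2) / Q * sin (Ψ s) ^ 2) = z at hz ⊢
    field_simp
  refine ⟨Ψ s₂, ?_, ?_⟩
  -- This y has rate 1/w, so it is the Mino time; evaluating it through the radial motion determines
  -- the final polar angle.
  · have h := sub_eq_integral_of_revolution (m := w) (g := fun _ => 1)
      (y := fun s => (∫ ψ in (0 : ℝ)..Ψ s, 1 / √(1 - a ^ 2 * (1 - E ^ 2) / Q * sin ψ ^ 2)) / √Q)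
      hαβ hβγ hγδ hl hrevx continuousOn_const hwpos hxdiff hxeq fun s hs => by
        convert! (hprim continuous_const s hs).div_const √Q using 1
        field_simp
    simp only [hΨ0, intervalIntegral.integral_same, zero_div, sub_zero] at h
    rw [← h]
    field_simp
  · have hcont : ContinuousOn (fun x => (x ^ 2 + a ^ 2) ^ 2 * E / Delta 1 a e x)
        (Set.Icc β α) := by
      have hD : Continuous (Delta 1 a e) := by unfold Delta; fun_prop
      exact ContinuousOn.div (by fun_prop) hD.continuousOn fun x hx => (hΔ x hx.1).ne'
    -- Adding the polar primitive to c·t/m cancels the sin²θ term of the time equation, leaving a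
    -- rate that depends on the radius alone.
    have h := sub_eq_integral_of_revolution (m := w)
      (g := fun x => (x ^ 2 + a ^ 2) ^ 2 * E / Delta 1 a e x)
      (y := fun s => c * t s / m + a ^ 2 * E / √Q *
        ∫ ψ in (0 : ℝ)..Ψ s, cos ψ ^ 2 / √(1 - a ^ 2 * (1 - E ^ 2) / Q * sin ψ ^ 2))
      hαβ hβγ hγδ hl hrevx hcont hwpos hxdiff hxeq fun s hs => by
        have h1 := hgeo.time_eq s hs
        rw [hrw, hrx, Delta_scale, hΨsin] at h1
        have hΔs := (hΔ _ (hxβ s hs)).ne'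
        have hws := (hwpos s hs).ne'
        convert! (((hgeo.differentiableAt_t s hs).hasDerivAt.const_mul c).div_const m).add
          ((hprim (f := fun ψ => cos ψ ^ 2) (by fun_prop) s hs).const_mul (a ^ 2 * E / √Q)) using 1
        have h2 : c * w s * deriv t s / m = (x s ^ 2 + a ^ 2) ^ 2 * E / Delta 1 a e (x s) -
            a ^ 2 * E * cos (Ψ s) ^ 2 := by
          refine mul_left_cancel₀ (pow_ne_zero 2 hm0) ?_
          have : m ^ 2 * (c * w s * deriv t s / m) = c * (w s * m) * deriv t s := by field_simp
          rw [this, h1]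
          field_simp
        field_simp at h2 ⊢
        linear_combination -h2
    simp only [hΨ0, intervalIntegral.integral_same, mul_zero, add_zero] at h
    rw [← h]
    field_simp
    ring

theorem Delta_eq_mul {a e : ℝ} (hae : a ^ 2 + e ^ 2 < 1) (x : ℝ) :
    Delta 1 a e x = (x - (1 + √(1 - a ^ 2 - e ^ 2))) * (x - (1 - √(1 - a ^ 2 - e ^ 2))) := by
  have h := sq_sqrt (show 0 ≤ 1 - a ^ 2 - e ^ 2 by linarith)
  rw [Delta]
  linear_combination h

/-- The partial fraction decomposition of the radial part of the time equation. -/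
theorem sq_div_Delta_eq {a e p q x : ℝ} (hΔ : Delta 1 a e x = (x - p) * (x - q))
    (hsum : p + q = 2) (hprod : p * q = a ^ 2 + e ^ 2) (hp : x ≠ p) (hq : x ≠ q) (hpq : p ≠ q) :
    (x ^ 2 + a ^ 2) ^ 2 / Delta 1 a e x = x ^ 2 + 2 * x + (a ^ 2 - e ^ 2 + 4) +
      ((8 - 4 * e ^ 2) * p - 4 * (a ^ 2 + e ^ 2) + e ^ 4) / (p - q) * (x - p)⁻¹ -
      ((8 - 4 * e ^ 2) * q - 4 * (a ^ 2 + e ^ 2) + e ^ 4) / (p - q) * (x - q)⁻¹ := by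
  have h1 := sub_ne_zero.2 hp
  have h2 := sub_ne_zero.2 hq
  have h3 := sub_ne_zero.2 hpq
  have ha : a ^ 2 = p * q - e ^ 2 := by linarith
  obtain rfl : q = 2 - p := by linarith
  rw [hΔ, ha]
  field_simp
  ring

theorem integral_time_radial {a e E α β γ δ p q : ℝ} (hαβ : β < α) (hβγ : γ < β) (hγδ : δ < γ)
    (hΔ : ∀ x, Delta 1 a e x = (x - p) * (x - q)) (hsum : p + q = 2)
    (hprod : p * q = a ^ 2 + e ^ 2) (hpq : p ≠ q) (hp : p < γ) (hq : q < γ) :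
    ∫ ψ in (0 : ℝ)..π, (uniformRadius α β γ ψ ^ 2 + a ^ 2) ^ 2 * E /
        Delta 1 a e (uniformRadius α β γ ψ) / √(1 - radialModulus α β γ δ * sin ψ ^ 2) =
      E * ((∫ ψ in (0 : ℝ)..π,
          uniformRadius α β γ ψ ^ 2 / √(1 - radialModulus α β γ δ * sin ψ ^ 2)) +
        2 * (∫ ψ in (0 : ℝ)..π,
          uniformRadius α β γ ψ / √(1 - radialModulus α β γ δ * sin ψ ^ 2)) +
        (a ^ 2 - e ^ 2 + 4) *
          (∫ ψ in (0 : ℝ)..π, 1 / √(1 - radialModulus α β γ δ * sin ψ ^ 2)) +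
        ((8 - 4 * e ^ 2) * p - 4 * (a ^ 2 + e ^ 2) + e ^ 4) / (p - q) *
          (∫ ψ in (0 : ℝ)..π, (uniformRadius α β γ ψ - p)⁻¹ /
            √(1 - radialModulus α β γ δ * sin ψ ^ 2)) -
        ((8 - 4 * e ^ 2) * q - 4 * (a ^ 2 + e ^ 2) + e ^ 4) / (p - q) *
          (∫ ψ in (0 : ℝ)..π, (uniformRadius α β γ ψ - q)⁻¹ /
            √(1 - radialModulus α β γ δ * sin ψ ^ 2))) := by
  have hint : ∀ {g : ℝ → ℝ}, ContinuousOn g (Set.Icc β α) → IntervalIntegrable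
      (fun ψ => g (uniformRadius α β γ ψ) / √(1 - radialModulus α β γ δ * sin ψ ^ 2))
      MeasureTheory.volume 0 π := fun hg =>
    (continuous_comp_uniformRadius_div hαβ hβγ hγδ hg).intervalIntegrable 0 π
  have hinv : ∀ {z : ℝ}, z < γ → ContinuousOn (fun x => (x - z)⁻¹) (Set.Icc β α) := fun hz =>
    ContinuousOn.inv₀ (by fun_prop) fun x hx => by linarith [hx.1]
  have i2 := hint (g := fun x => x ^ 2) (by fun_prop)
  have i1 := hint (g := fun x => x) (by fun_prop)
  have i0 := hint (g := fun _ => 1) (by fun_prop)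
  have ip := hint (hinv hp)
  have iq := hint (hinv hq)
  have e : ∀ ψ, (uniformRadius α β γ ψ ^ 2 + a ^ 2) ^ 2 * E /
        Delta 1 a e (uniformRadius α β γ ψ) / √(1 - radialModulus α β γ δ * sin ψ ^ 2) =
      E * (uniformRadius α β γ ψ ^ 2 / √(1 - radialModulus α β γ δ * sin ψ ^ 2) +
        2 * (uniformRadius α β γ ψ / √(1 - radialModulus α β γ δ * sin ψ ^ 2)) +
        (a ^ 2 - e ^ 2 + 4) * (1 / √(1 - radialModulus α β γ δ * sin ψ ^ 2)) +
        ((8 - 4 * e ^ 2) * p - 4 * (a ^ 2 + e ^ 2) + e ^ 4) / (p - q) *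
          ((uniformRadius α β γ ψ - p)⁻¹ / √(1 - radialModulus α β γ δ * sin ψ ^ 2)) -
        ((8 - 4 * e ^ 2) * q - 4 * (a ^ 2 + e ^ 2) + e ^ 4) / (p - q) *
          ((uniformRadius α β γ ψ - q)⁻¹ / √(1 - radialModulus α β γ δ * sin ψ ^ 2))) := by
    intro ψ
    have hb := (uniformRadius_mem_Icc hαβ hβγ ψ).1
    rw [mul_comm _ E, mul_div_assoc E, sq_div_Delta_eq (hΔ _) hsum hprod (by linarith)
      (by linarith) hpq]
    ring
  simp only [e]
  rw [intervalIntegral.integral_const_mul,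
    intervalIntegral.integral_sub ((((i2.add (i1.const_mul _)).add (i0.const_mul _)).add
      (ip.const_mul _))) (iq.const_mul _),
    intervalIntegral.integral_add ((i2.add (i1.const_mul _)).add (i0.const_mul _))
      (ip.const_mul _),
    intervalIntegral.integral_add (i2.add (i1.const_mul _)) (i0.const_mul _),
    intervalIntegral.integral_add i2 (i1.const_mul _)]
  simp only [intervalIntegral.integral_const_mul]

end KerrNewman
end

/-! ### Assembly of the closed formula. -/

theorem mainTheorem11
    -- units, and the dimensionless spin, charge, energy, and Carter constant
    (G M c rg a e E Q : ℝ) (hG : 0 < G) (hM : 0 < M) (hc : 0 < c) (hrg : rg = G * M / c ^ 2)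
    (ha : a ≠ 0) (hae : a ^ 2 + e ^ 2 < 1) (hE : E ^ 2 < 1) (hQ : a ^ 2 * (1 - E ^ 2) < Q)
    -- the dimensionless horizon radii, and the roots of the dimensionless radial quartic
    (rplus rminus α β γ δ : ℝ)
    (hrplus : rplus = 1 + √(1 - a ^ 2 - e ^ 2)) (hrminus : rminus = 1 - √(1 - a ^ 2 - e ^ 2))
    (hαβ : β < α) (hβγ : γ < β) (hγδ : δ < γ)
    (hα : KerrNewman.radialPoly 1 a e E Q α = 0) (hβ : KerrNewman.radialPoly 1 a e E Q β = 0)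
    (hγ : KerrNewman.radialPoly 1 a e E Q γ = 0) (hδ : KerrNewman.radialPoly 1 a e E Q δ = 0)
    (hhor : rplus < β)
    -- the orbit between two successive periapsis passages, the first in the equatorial plane
    (t r θ ϕ : ℝ → ℝ) (s₀ s₁ s₂ : ℝ)
    (hgeo : KerrNewman.IsPolarGeodesicOn c rg (a * rg) (e * rg) E (Q * rg ^ 2)
      (Set.Icc s₀ s₂) t r θ ϕ)
    (hrev : KerrNewman.IsRadialRevolution r (β * rg) (α * rg) s₀ s₁ s₂)
    (hequator : cos (θ s₀) = 0)
    -- abbreviations used in the formula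
    (ω κ2 κplus2 κminus2 κ'2 Hplus Hminus Aplus Aminus φ : ℝ)
    (hω : ω = (α - β) / (α - γ))
    (hκ2 : κ2 = (α - β) / (α - γ) * ((δ - γ) / (δ - β)))
    (hκplus2 : κplus2 = (α - β) / (α - γ) * ((rplus - γ) / (rplus - β)))
    (hκminus2 : κminus2 = (α - β) / (α - γ) * ((rminus - γ) / (rminus - β)))
    (hκ'2 : κ'2 = a ^ 2 * (1 - E ^ 2) / Q)
    (hHplus : Hplus = √(1 - E ^ 2) * (β - rplus) * √(α - β) * √(β - δ))
    (hHminus : Hminus = √(1 - E ^ 2) * (β - rminus) * √(α - β) * √(β - δ))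
    (hAplus : Aplus = -((a ^ 2 + e ^ 2 - 2 * rplus) / (rminus - rplus)))
    (hAminus : Aminus = -((-a ^ 2 - e ^ 2 + 2 * rminus) / (rminus - rplus)))
    (hφ : φ = KerrNewman.jacobiAm
      (√Q * (4 / √(1 - E ^ 2)) * (1 / √(α - γ)) * (1 / √(β - δ)) * (π / 2) *
        ordinaryHypergeometric (1 / 2 : ℝ) (1 / 2 : ℝ) (1 : ℝ) κ2) κ'2) :
    ∃ Splus Sminus : ℝ → ℝ,
      KerrNewman.IsAppellContinuation (1 / 2) κ'2 Splus ∧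
      KerrNewman.IsAppellContinuation (-1 / 2) κ'2 Sminus ∧
      c * (t s₂ - t s₀) =
        E * β ^ 2 * 2 * rg / (√(1 - E ^ 2) * √(α - γ) * √(β - δ)) *
          (π * KerrNewman.appellF1 (1 / 2) 2 (1 / 2) 1 ω κ2
            - 2 * ω * γ / β * (π / 2) * KerrNewman.appellF1 (3 / 2) 2 (1 / 2) 2 ω κ2
            + γ ^ 2 * ω ^ 2 / β ^ 2 * (3 * π / 8) *
                KerrNewman.appellF1 (5 / 2) 2 (1 / 2) 3 ω κ2)
        + 2 * E * (a ^ 2 - e ^ 2) * rg * √(ω / (1 - E ^ 2)) * (1 / √((α - β) * (β - δ))) *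
            ordinaryHypergeometric (1 / 2 : ℝ) (1 / 2 : ℝ) (1 : ℝ) κ2 * π
        + 4 * E * rg * √(ω / (1 - E ^ 2)) * (β / √((α - β) * (β - δ))) *
            (π * KerrNewman.appellF1 (1 / 2) 1 (1 / 2) 1 ω κ2
              - ω * γ / β * KerrNewman.appellF1 (3 / 2) 1 (1 / 2) 2 ω κ2 * (π / 2))
        + 8 * E * rg * √(ω / (1 - E ^ 2)) * (1 / √((α - β) * (β - δ))) *
            ordinaryHypergeometric (1 / 2 : ℝ) (1 / 2 : ℝ) (1 : ℝ) κ2 * π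
        - 8 * E * rg *
            (-(ω ^ (3 / 2 : ℝ) * Aplus / Hplus) *
                KerrNewman.appellF1 (3 / 2) 1 (1 / 2) 2 κplus2 κ2 * (π / 2)
              + ω ^ (1 / 2 : ℝ) * Aplus / Hplus *
                KerrNewman.appellF1 (1 / 2) 1 (1 / 2) 1 κplus2 κ2 * π
              - ω ^ (3 / 2 : ℝ) * Aminus / Hminus *
                KerrNewman.appellF1 (3 / 2) 1 (1 / 2) 2 κminus2 κ2 * (π / 2)
              + ω ^ (1 / 2 : ℝ) * Aminus / Hminus *
                KerrNewman.appellF1 (1 / 2) 1 (1 / 2) 1 κminus2 κ2 * π)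
        + 2 * E * rg *
            (-(ω ^ (3 / 2 : ℝ) * (4 * e ^ 2 * rplus - e ^ 4) /
                  (-2 * √(1 - a ^ 2 - e ^ 2) * Hplus)) *
                KerrNewman.appellF1 (3 / 2) 1 (1 / 2) 2 κplus2 κ2 * (π / 2)
              + ω ^ (1 / 2 : ℝ) * (4 * e ^ 2 * rplus - e ^ 4) /
                  (-2 * √(1 - a ^ 2 - e ^ 2) * Hplus) *
                KerrNewman.appellF1 (1 / 2) 1 (1 / 2) 1 κplus2 κ2 * π
              - ω ^ (3 / 2 : ℝ) * (e ^ 4 - 4 * e ^ 2 * rminus) /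
                  (-2 * √(1 - a ^ 2 - e ^ 2) * Hminus) *
                KerrNewman.appellF1 (3 / 2) 1 (1 / 2) 2 κminus2 κ2 * (π / 2)
              + ω ^ (1 / 2 : ℝ) * (e ^ 4 - 4 * e ^ 2 * rminus) /
                  (-2 * √(1 - a ^ 2 - e ^ 2) * Hminus) *
                KerrNewman.appellF1 (1 / 2) 1 (1 / 2) 1 κminus2 κ2 * π)
        + -(a ^ 2) * E * rg / √Q *
            (Splus φ + (-Splus φ + Sminus φ) * (1 / κ'2)) := by
  have hl : 0 < 1 - E ^ 2 := sub_pos.2 hE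
  have hQ0 : 0 < Q := (mul_nonneg (sq_nonneg a) hl.le).trans_lt hQ
  have hrg0 : 0 < rg := by rw [hrg]; positivity
  have hq0 : 0 < √(1 - a ^ 2 - e ^ 2) := sqrt_pos.2 (by linarith)
  have hq2 := sq_sqrt (show 0 ≤ 1 - a ^ 2 - e ^ 2 by linarith)
  have hβ0 : 0 < β := by linarith
  have hΔ : ∀ x, KerrNewman.Delta 1 a e x = (x - rplus) * (x - rminus) := fun x => by
    rw [hrplus, hrminus]; exact KerrNewman.Delta_eq_mul hae x
  have hΔpos : ∀ x, β ≤ x → 0 < KerrNewman.Delta 1 a e x := fun x hx => by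
    rw [hΔ]; exact mul_pos (by linarith) (by linarith)
  have hR := KerrNewman.radialPoly_eq_of_roots hαβ hβγ hγδ hα hβ hγ hδ
  -- For E = 0 the quartic at β would be -Δ(β)(β² + Q), which is negative outside the horizon.
  have hE0 : E ≠ 0 := by
    rintro rfl
    have h1 := hΔpos β le_rfl
    simp only [KerrNewman.radialPoly] at hβ
    nlinarith [mul_pos h1 (add_pos (pow_pos hβ0 2) hQ0)]
  have hpγ : rplus < γ := KerrNewman.lt_of_Delta_eq_zero ha hE hE0 hαβ hγδ hR
    (by rw [hΔ]; ring) hhor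
  have hmγ : rminus < γ := by linarith
  have hk0 : 0 < κ'2 := by rw [hκ'2]; positivity
  have hk1 : κ'2 < 1 := by rw [hκ'2]; exact (div_lt_one hQ0).2 hQ
  obtain ⟨Ψ, hΨ, ht⟩ := KerrNewman.exists_time_of_revolution hrg0 ha hE hQ hαβ hβγ hγδ hβ0 hR
    hΔpos hgeo hrev hequator
  rw [KerrNewman.integral_one_radial hαβ hβγ hγδ, ← hκ'2] at hΨ
  have hφΨ : φ = Ψ := by
    rw [hφ, ← KerrNewman.jacobiAm_integral hk0.le hk1 Ψ, hΨ, hκ2, KerrNewman.radialModulus]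
    congr 1
    field_simp
    ring
  refine ⟨_, _, KerrNewman.isAppellContinuation_integral _ hk0.le hk1,
    KerrNewman.isAppellContinuation_integral _ hk0.le hk1, ?_⟩
  rw [hφΨ, ← KerrNewman.integral_cos_sq_div_eq hk0 hk1]
  rw [ht, KerrNewman.integral_time_radial hαβ hβγ hγδ hΔ (by rw [hrplus, hrminus]; ring)
    (by rw [hrplus, hrminus]; linear_combination -hq2) (by linarith) hpγ hmγ,
    KerrNewman.integral_one_radial hαβ hβγ hγδ, KerrNewman.integral_radius hαβ hβγ hγδ,
    KerrNewman.integral_radius_sq hαβ hβγ hγδ, KerrNewman.integral_inv_radius_sub hαβ hβγ hγδ hpγ,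
    KerrNewman.integral_inv_radius_sub hαβ hβγ hγδ hmγ, ← hκ'2, KerrNewman.radialModulus, ← hκ2,
    ← hκplus2, ← hκminus2, ← hω]
  have hαγ0 : 0 < α - γ := by linarith
  have hαβ0 : 0 < α - β := by linarith
  have hβδ0 : 0 < β - δ := by linarith
  have hω0 : 0 < ω := by rw [hω]; positivity
  have hωsqrt : √ω * √(α - γ) = √(α - β) := by
    rw [hω, ← sqrt_mul (by positivity), div_mul_cancel₀ _ hαγ0.ne']
  have hpre : √(ω / (1 - E ^ 2)) * (1 / √((α - β) * (β - δ))) =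
      1 / (√(1 - E ^ 2) * √(α - γ) * √(β - δ)) := by
    rw [sqrt_div hω0.le, sqrt_mul hαβ0.le, ← hωsqrt]
    field_simp
  have hω12 : ω ^ (1 / 2 : ℝ) = √ω := (sqrt_eq_rpow ω).symm
  have hω32 : ω ^ (3 / 2 : ℝ) = ω * √ω := by
    rw [show (3 / 2 : ℝ) = 1 + 1 / 2 by norm_num, rpow_add hω0, rpow_one, hω12]
  -- From √ω √(α - γ) = √(α - β), every prefactor reduces to the common one, 1/C with C = √(1 - E²)
  -- √(α - γ) √(β - δ).
  have hH : ∀ x, √ω / (√(1 - E ^ 2) * (β - x) * √(α - β) * √(β - δ)) =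
      1 / (√(1 - E ^ 2) * √(α - γ) * √(β - δ)) * (1 / (β - x)) := fun x => by
    rw [← hωsqrt]
    field_simp
  have hHp := hH rplus
  have hHm := hH rminus
  rw [← hHplus] at hHp
  rw [← hHminus] at hHm
  have hpm : rplus - rminus = 2 * √(1 - a ^ 2 - e ^ 2) := by rw [hrplus, hrminus]; ring
  have hmp : rminus - rplus = -(2 * √(1 - a ^ 2 - e ^ 2)) := by rw [hrplus, hrminus]; ring
  rw [hω32, hω12, hAplus, hAminus, hpm, hmp]
  generalize KerrNewman.appellF1 (1 / 2) 1 (1 / 2) 1 ω κ2 = F₁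
  generalize KerrNewman.appellF1 (3 / 2) 1 (1 / 2) 2 ω κ2 = F₂
  generalize KerrNewman.appellF1 (1 / 2) 2 (1 / 2) 1 ω κ2 = G₁
  generalize KerrNewman.appellF1 (3 / 2) 2 (1 / 2) 2 ω κ2 = G₂
  generalize KerrNewman.appellF1 (5 / 2) 2 (1 / 2) 3 ω κ2 = G₃
  generalize KerrNewman.appellF1 (1 / 2) 1 (1 / 2) 1 κplus2 κ2 = P₁
  generalize KerrNewman.appellF1 (3 / 2) 1 (1 / 2) 2 κplus2 κ2 = P₂
  generalize KerrNewman.appellF1 (1 / 2) 1 (1 / 2) 1 κminus2 κ2 = M₁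
  generalize KerrNewman.appellF1 (3 / 2) 1 (1 / 2) 2 κminus2 κ2 = M₂
  generalize ordinaryHypergeometric (1 / 2 : ℝ) (1 / 2 : ℝ) (1 : ℝ) κ2 = K
  have hb1 : β * (π * F₁ - ω * γ / β * F₂ * (π / 2)) =
      β * π * F₁ - γ * ω * (π / 2) * F₂ := by
    field_simp
  have hb2 : β ^ 2 * (π * G₁ - 2 * ω * γ / β * (π / 2) * G₂ +
      γ ^ 2 * ω ^ 2 / β ^ 2 * (3 * π / 8) * G₃) =
      β ^ 2 * π * G₁ - 2 * β * γ * ω * (π / 2) * G₂ + γ ^ 2 * ω ^ 2 * (3 * π / 8) * G₃ := by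
    field_simp
  generalize √(1 - a ^ 2 - e ^ 2) = q at hq0 ⊢
  generalize √(1 - E ^ 2) * √(α - γ) * √(β - δ) = C at hpre hHp hHm ⊢
  -- Each partial-fraction residue at a horizon is split into its A± part and the part made of e²
  -- r'± and e⁴; together these are the coefficients of `hHp` and `hHm`.
  linear_combination (-(2 * E * (a ^ 2 - e ^ 2) * rg * K * π +
      4 * E * rg * β * (π * F₁ - ω * γ / β * F₂ * (π / 2)) + 8 * E * rg * K * π)) * hpre -
    4 * E * rg * (1 / C) * hb1 - 2 * E * rg * (1 / C) * hb2 -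
    (-8 * E * rg * (a ^ 2 + e ^ 2 - 2 * rplus) / (2 * q) -
      2 * E * rg * (4 * e ^ 2 * rplus - e ^ 4) / (2 * q)) * (π * P₁ - ω * (π / 2) * P₂) * hHp -
    (-8 * E * rg * (-a ^ 2 - e ^ 2 + 2 * rminus) / (2 * q) -
      2 * E * rg * (e ^ 4 - 4 * e ^ 2 * rminus) / (2 * q)) * (π * M₁ - ω * (π / 2) * M₂) * hHm
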